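/- Let $\eta=\mathrm{diag}(1,-1,-1,-1)$ and let all indices run over $\{0,1,2,3\}$; indices are raised with $\eta$. Let $\mathcal P$ be the unital graded-commutative complex algebra of polynomials in the variables $v_{\mu;\rho_1\dots\rho_n}$ (even) and $u_{\rho_1\dots\rho_n},\ \tilde u_{\rho_1\dots\rho_n}$ (odd), $n\ge 0$, which stand for the derivatives $d_{\rho_1}\cdots d_{\rho_n}$ of the fields $v_\mu,u,\tilde u$, are symmetric in $\rho_1,\dots,\rho_n$, and are subject to the massless field equations $\eta^{\rho\sigma}y_{\rho\sigma\rho_3\dots\rho_n}=0$ for every field $y\in\{v_\mu,u,\tilde u\}$. Write $B=d_\mu v^\mu$, let a multi-index on $B$ denote derivatives, and let $d_Q$ be the odd derivation of $\mathcal P$ with $$d_Qv_\mu=i\,d_\mu u,\qquad d_Qu=0,\qquad d_Q\tilde u=-i\,B,\qquad [d_Q,d_\mu]=0 .$$ Then $d_Q^2=0$; put $Z_Q=\ker d_Q$, $B_Q=\operatorname{im} d_Q$, $H_Q=Z_Q/B_Q$. Let $F_{\mu\nu}=d_\mu v_\nu-d_\nu v_\mu$, let $F_{\mu\nu;\rho_1\dots\rho_n}$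 be its derivatives, and let $$F^{(0)}_{\mu\nu;\rho_1\dots\rho_n}=F_{\mu\nu;\rho_1\dots\rho_n}+\frac1{n+2}\sum_{l=1}^n\left[\eta_{\mu\rho_l}B_{\nu\rho_1\dots\hat\rho_l\dots\rho_n}-\eta_{\nu\rho_l}B_{\mu\rho_1\dots\hat\rho_l\dots\rho_n}\right]\qquad(n\ge 0)$$ be its traceless part: it is antisymmetric in $\mu,\nu$, symmetric in the $\rho_l$, and traceless in all indices. Let $\mathcal P_0\subset\mathcal P$ be the subalgebra of polynomials in $u$ and the $F^{(0)}_{\mu\nu;\rho_1\dots\rho_n}$. **Theorem.** (a) Every $p\in Z_Q$ is cohomologous to an element of $\mathcal P_0$: there is $p_0\in\mathcal P_0$ with $p-p_0\in B_Q$. (b) Let $\hat{\mathcal P}_0$ be the unital graded-commutative complex algebra generated by an odd variable $u$ and even variables $F^{(0)}_{\mu\nu;\rho_1\dots\rho_n}$ ($n\ge0$), antisymmetric in $\mu,\nu$, symmetric in the $\rho_l$ and traceless in all indices, and let $\mathcal I$ be its two-sided ideal generated by the Bianchi identities $$F^{(0)}_{\mu\nu;\rho\rho_1\dots\rho_n}+F^{(0)}_{\nu\rho;\mu\rho_1\dots\rho_n}+F^{(0)}_{\rho\mu;\nu\rho_1\dots\rho_n}\qquad(n\ge0).$$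 Then the natural map $\hat{\mathcal P}_0\to\mathcal P$ takes values in $Z_Q$ and induces an isomorphism of complex vector spaces $\hat{\mathcal P}_0/\mathcal I\cong H_Q$. -/

import Mathlib

namespace GaugeCohomology

noncomputable section

/-! ### Polynomials in commuting and anticommuting variables -/

/-- The Koszul sign `(-1)^{|x||y|}`; `true` stands for odd. -/
def koszul (a b : Bool) : ℂ := if a && b then -1 else 1

section Super

variable {ι : Type} (odd : ι → Bool) (R : Set (FreeAlgebra ℂ ι))

/-- Graded commutativity of the generators, together with relators `r = 0` for `r ∈ R`. -/
inductive SuperRel : FreeAlgebra ℂ ι → FreeAlgebra ℂ ι → Prop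
  | swap (x y : ι) : SuperRel (FreeAlgebra.ι ℂ x * FreeAlgebra.ι ℂ y)
      (koszul (odd x) (odd y) • (FreeAlgebra.ι ℂ y * FreeAlgebra.ι ℂ x))
  | rel (r : FreeAlgebra ℂ ι) (hr : r ∈ R) : SuperRel r 0

/-- The unital graded-commutative complex algebra of polynomials in the variables `ι`
(`odd x = true` for Grassmann variables), modulo the relators `R`. An odd variable squares to
zero, because it anticommutes with itself. -/
def SuperPoly : Type := RingQuot (SuperRel odd R)

instance : Ring (SuperPoly odd R) := inferInstanceAs (Ring (RingQuot (SuperRel odd R)))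

instance : Algebra ℂ (SuperPoly odd R) :=
  inferInstanceAs (Algebra ℂ (RingQuot (SuperRel odd R)))

/-- The class of a noncommutative polynomial. -/
def SuperPoly.mk : FreeAlgebra ℂ ι →ₐ[ℂ] SuperPoly odd R :=
  RingQuot.mkAlgHom ℂ (SuperRel odd R)

/-- A variable, as an element of the polynomial algebra. -/
def SuperPoly.gen (x : ι) : SuperPoly odd R := SuperPoly.mk odd R (FreeAlgebra.ι ℂ x)

theorem SuperPoly.mk_ι (x : ι) :
    SuperPoly.mk odd R (FreeAlgebra.ι ℂ x) = SuperPoly.gen odd R x := rfl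

theorem SuperPoly.gen_mul_gen (x y : ι) :
    SuperPoly.gen odd R x * SuperPoly.gen odd R y =
      koszul (odd x) (odd y) • (SuperPoly.gen odd R y * SuperPoly.gen odd R x) := by
  have h : SuperPoly.mk odd R (FreeAlgebra.ι ℂ x * FreeAlgebra.ι ℂ y) = SuperPoly.mk odd R
      (koszul (odd x) (odd y) • (FreeAlgebra.ι ℂ y * FreeAlgebra.ι ℂ x)) :=
    RingQuot.mkAlgHom_rel ℂ (SuperRel.swap (odd := odd) (R := R) x y)
  simpa only [map_mul, map_smul, SuperPoly.mk_ι] using h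

theorem SuperPoly.mk_eq_zero {r : FreeAlgebra ℂ ι} (hr : r ∈ R) : SuperPoly.mk odd R r = 0 := by
  have h : SuperPoly.mk odd R r = SuperPoly.mk odd R 0 :=
    RingQuot.mkAlgHom_rel ℂ (SuperRel.rel (odd := odd) r hr)
  simpa only [map_zero] using h

theorem SuperPoly.mk_surjective : Function.Surjective (SuperPoly.mk odd R) :=
  RingQuot.mkAlgHom_surjective ℂ (SuperRel odd R)

/-- Universal property. -/
def SuperPoly.lift {A : Type} [Ring A] [Algebra ℂ A] (f : ι → A)
    (hswap : ∀ x y, f x * f y = koszul (odd x) (odd y) • (f y * f x))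
    (hrel : ∀ r ∈ R, FreeAlgebra.lift ℂ f r = 0) : SuperPoly odd R →ₐ[ℂ] A :=
  RingQuot.liftAlgHom ℂ ⟨FreeAlgebra.lift ℂ f, by
    intro a b h
    cases h with
    | swap x y => simpa using hswap x y
    | rel _ hr => simpa using hrel _ hr⟩

theorem SuperPoly.lift_mk {A : Type} [Ring A] [Algebra ℂ A] (f : ι → A)
    (hswap : ∀ x y, f x * f y = koszul (odd x) (odd y) • (f y * f x))
    (hrel : ∀ r ∈ R, FreeAlgebra.lift ℂ f r = 0) (a : FreeAlgebra ℂ ι) :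
    SuperPoly.lift odd R f hswap hrel (SuperPoly.mk odd R a) = FreeAlgebra.lift ℂ f a :=
  RingQuot.liftAlgHom_mkAlgHom_apply ℂ _ _ _

theorem SuperPoly.lift_gen {A : Type} [Ring A] [Algebra ℂ A] (f : ι → A)
    (hswap : ∀ x y, f x * f y = koszul (odd x) (odd y) • (f y * f x))
    (hrel : ∀ r ∈ R, FreeAlgebra.lift ℂ f r = 0) (x : ι) :
    SuperPoly.lift odd R f hswap hrel (SuperPoly.gen odd R x) = f x := by
  rw [SuperPoly.gen, SuperPoly.lift_mk, FreeAlgebra.lift_ι_apply]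

/-- The upper triangular matrix which encodes a graded derivation: if `D` is a graded derivation
of parity `k`, then `a ↦ !![(-1)^{k|a|} a, D a; 0, a]` is multiplicative. -/
def derivMatrix (k : Bool) (δ : ι → SuperPoly odd R) (x : ι) :
    Matrix (Fin 2) (Fin 2) (SuperPoly odd R) :=
  !![koszul k (odd x) • SuperPoly.gen odd R x, δ x; 0, SuperPoly.gen odd R x]

/-- The graded derivation of parity `k` with values `δ` on the variables, for `δ` compatible with
the relations. -/
def SuperPoly.derivation (k : Bool) (δ : ι → SuperPoly odd R)
    (hswap : ∀ x y, derivMatrix odd R k δ x * derivMatrix odd R k δ y =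
      koszul (odd x) (odd y) • (derivMatrix odd R k δ y * derivMatrix odd R k δ x))
    (hrel : ∀ r ∈ R, FreeAlgebra.lift ℂ (derivMatrix odd R k δ) r = 0) :
    SuperPoly odd R →ₗ[ℂ] SuperPoly odd R :=
  Matrix.entryLinearMap ℂ (SuperPoly odd R) (0 : Fin 2) (1 : Fin 2) ∘ₗ
    (SuperPoly.lift odd R (derivMatrix odd R k δ) hswap hrel).toLinearMap

variable (k : Bool) (δ : ι → SuperPoly odd R)
    (hswap : ∀ x y, derivMatrix odd R k δ x * derivMatrix odd R k δ y =
      koszul (odd x) (odd y) • (derivMatrix odd R k δ y * derivMatrix odd R k δ x))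
    (hrel : ∀ r ∈ R, FreeAlgebra.lift ℂ (derivMatrix odd R k δ) r = 0)

theorem SuperPoly.derivation_gen (x : ι) :
    SuperPoly.derivation odd R k δ hswap hrel (SuperPoly.gen odd R x) = δ x := by
  simp [SuperPoly.derivation, SuperPoly.lift_gen, derivMatrix]

theorem SuperPoly.derivation_one :
    SuperPoly.derivation odd R k δ hswap hrel 1 = 0 := by
  simp [SuperPoly.derivation]

/-- The graded Leibniz rule. -/
theorem SuperPoly.derivation_gen_mul (x : ι) (b : SuperPoly odd R) :
    SuperPoly.derivation odd R k δ hswap hrel (SuperPoly.gen odd R x * b) =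
      δ x * b + koszul k (odd x) •
        (SuperPoly.gen odd R x * SuperPoly.derivation odd R k δ hswap hrel b) := by
  obtain ⟨b, rfl⟩ := SuperPoly.mk_surjective odd R b
  have key : SuperPoly.lift odd R (derivMatrix odd R k δ) hswap hrel (SuperPoly.mk odd R b) 1 1
      = SuperPoly.mk odd R b ∧
      SuperPoly.lift odd R (derivMatrix odd R k δ) hswap hrel (SuperPoly.mk odd R b) 1 0 = 0 := by
    rw [SuperPoly.lift_mk]
    induction b using FreeAlgebra.induction with
    | grade0 r => simp [Matrix.algebraMap_matrix_apply]
    | grade1 x => simp [derivMatrix, SuperPoly.mk_ι]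
    | mul a b ha hb => simp [Matrix.mul_apply, Fin.sum_univ_two, ha, hb]
    | add a b ha hb => simp [ha, hb]
  simp only [SuperPoly.derivation, LinearMap.comp_apply, AlgHom.toLinearMap_apply, map_mul,
    SuperPoly.lift_gen, Matrix.entryLinearMap_apply, Matrix.mul_apply, Fin.sum_univ_two, key.1]
  simp [derivMatrix, add_comm]

/-- Sufficient condition for compatibility with graded commutativity. -/
theorem derivMatrix_swap
    (h : ∀ x y, δ x * SuperPoly.gen odd R y =
      koszul (xor k (odd x)) (odd y) • (SuperPoly.gen odd R y * δ x)) (x y : ι) :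
    derivMatrix odd R k δ x * derivMatrix odd R k δ y =
      koszul (odd x) (odd y) • (derivMatrix odd R k δ y * derivMatrix odd R k δ x) := by
  have h1 := h x y
  have h2 := h y x
  have h3 := SuperPoly.gen_mul_gen odd R x y
  ext i j
  fin_cases i <;> fin_cases j <;>
    simp [derivMatrix, Matrix.mul_apply, Fin.sum_univ_two] <;>
    (cases k <;> cases hx : odd x <;> cases hy : odd y <;>
      simp [koszul, hx, hy] at h1 h2 h3 ⊢) <;>
    simp [h1, h2, h3, add_comm]

/-- Induction over the words in the variables. -/
theorem SuperPoly.induction {p : SuperPoly odd R → Prop} (one : p 1)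
    (gen_mul : ∀ x b, p b → p (SuperPoly.gen odd R x * b))
    (add : ∀ a b, p a → p b → p (a + b)) (smul : ∀ (c : ℂ) a, p a → p (c • a))
    (a : SuperPoly odd R) : p a := by
  obtain ⟨a, rfl⟩ := SuperPoly.mk_surjective odd R a
  suffices h : ∀ b, p b → p (SuperPoly.mk odd R a * b) by simpa using h 1 one
  induction a using FreeAlgebra.induction with
  | grade0 r => intro b hb; simpa [Algebra.algebraMap_eq_smul_one] using smul r b hb
  | grade1 x => exact gen_mul x
  | mul a b ha hb => intro c hc; simpa [mul_assoc] using ha _ (hb c hc)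
  | add a b ha hb => intro c hc; simpa [add_mul] using add _ _ (ha c hc) (hb c hc)

end Super

/-! ### The massless fields on shell -/

/-- The Minkowski metric with diagonal `1, -1, -1, -1`. -/
def eta (μ ν : Fin 4) : ℂ := if μ = ν then (if μ = 0 then 1 else -1) else 0

theorem eta_sum {M : Type} [AddCommGroup M] [Module ℂ M] (f : Fin 4 → Fin 4 → M) :
    ∑ ρ, ∑ σ, eta ρ σ • f ρ σ = f 0 0 - f 1 1 - f 2 2 - f 3 3 := by
  simp [Fin.sum_univ_four, eta]
  abel

/-- The fields: the vector field `v_μ` and the ghosts `u`, `ũ`. -/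
inductive FieldName
  | v (μ : Fin 4)
  | u
  | uTilde

/-- The ghosts are Grassmann odd. -/
def FieldName.odd : FieldName → Bool
  | .v _ => false
  | .u => true
  | .uTilde => true

/-- The variables `y_{;μ₁…μₙ} = d_{μ₁}…d_{μₙ} y`: a field together with the multiset of
derivative indices (the order of the derivatives is immaterial). -/
abbrev JetVar : Type := FieldName × Multiset (Fin 4)

def JetVar.odd (x : JetVar) : Bool := x.1.odd

/-- The derivatives of the massless field equation `η^{ρσ} d_ρ d_σ y = 0`. -/
def onShell : Set (FreeAlgebra ℂ JetVar) :=
  {r | ∃ (y : FieldName) (J : Multiset (Fin 4)),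
    r = ∑ ρ, ∑ σ, eta ρ σ • FreeAlgebra.ι ℂ ((y, ρ ::ₘ σ ::ₘ J) : JetVar)}

/-- The algebra `𝒫` of polynomials in the on-shell fields and their derivatives. -/
abbrev P : Type := SuperPoly JetVar.odd onShell

/-- The element `y_{;J}` of `𝒫`. -/
def jet (y : FieldName) (J : Multiset (Fin 4)) : P := SuperPoly.gen JetVar.odd onShell (y, J)

theorem jet_onShell (y : FieldName) (J : Multiset (Fin 4)) :
    ∑ ρ, ∑ σ, eta ρ σ • jet y (ρ ::ₘ σ ::ₘ J) = 0 := by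
  have h := SuperPoly.mk_eq_zero JetVar.odd onShell ⟨y, J, rfl⟩
  simpa only [map_sum, map_smul, SuperPoly.mk_ι, jet] using h

theorem jet_mul_jet (x y : FieldName) (J K : Multiset (Fin 4)) :
    jet x J * jet y K = koszul x.odd y.odd • (jet y K * jet x J) :=
  SuperPoly.gen_mul_gen JetVar.odd onShell (x, J) (y, K)

/-- `B_{;J}`, the derivatives of `B = d_μ v^μ`. -/
def B (J : Multiset (Fin 4)) : P := ∑ ρ, ∑ σ, eta ρ σ • jet (.v σ) (ρ ::ₘ J)

theorem B_onShell (J : Multiset (Fin 4)) :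
    ∑ ρ, ∑ σ, eta ρ σ • B (ρ ::ₘ σ ::ₘ J) = 0 := by
  have h := fun (μ ν : Fin 4) => jet_onShell (.v μ) (ν ::ₘ J)
  have hc : ∀ a b : Fin 4, a ::ₘ b ::ₘ b ::ₘ J = b ::ₘ b ::ₘ a ::ₘ J := fun a b => by
    rw [Multiset.cons_swap a b, Multiset.cons_swap a b]
  have hB : ∀ b, B (b ::ₘ b ::ₘ J) = jet (.v 0) (b ::ₘ b ::ₘ 0 ::ₘ J)
      - jet (.v 1) (b ::ₘ b ::ₘ 1 ::ₘ J) - jet (.v 2) (b ::ₘ b ::ₘ 2 ::ₘ J)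
      - jet (.v 3) (b ::ₘ b ::ₘ 3 ::ₘ J) := fun b => by
    simp only [B, eta_sum, hc 0, hc 1, hc 2, hc 3]
  simp only [eta_sum] at h
  simp only [eta_sum, hB]
  linear_combination (norm := abel) h 0 0 - h 1 1 - h 2 2 - h 3 3

theorem jet_mul_B (y : FieldName) (J K : Multiset (Fin 4)) : jet y J * B K = B K * jet y J := by
  simp only [B, eta_sum, mul_sub, sub_mul]
  simp [jet_mul_jet y (.v _), koszul, FieldName.odd]

/-! ### The formal derivatives and the gauge charge differential -/

/-- The value of `d_μ` on the variables. -/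
def formalDerivVar (μ : Fin 4) (x : JetVar) : P := jet x.1 (μ ::ₘ x.2)

theorem formalDerivVar_swap (μ : Fin 4) (x y : JetVar) :
    derivMatrix JetVar.odd onShell false (formalDerivVar μ) x *
      derivMatrix JetVar.odd onShell false (formalDerivVar μ) y = koszul x.odd y.odd •
        (derivMatrix JetVar.odd onShell false (formalDerivVar μ) y *
          derivMatrix JetVar.odd onShell false (formalDerivVar μ) x) :=
  derivMatrix_swap _ _ _ _ (by
    rintro ⟨x, J⟩ ⟨y, K⟩
    simpa [formalDerivVar, JetVar.odd, jet] using jet_mul_jet x y (μ ::ₘ J) K) x y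

theorem formalDerivVar_rel (μ : Fin 4) (r : FreeAlgebra ℂ JetVar) (hr : r ∈ onShell) :
    FreeAlgebra.lift ℂ (derivMatrix JetVar.odd onShell false (formalDerivVar μ)) r = 0 := by
  obtain ⟨y, J, rfl⟩ := hr
  have h1 := jet_onShell y J
  have h2 := jet_onShell y (μ ::ₘ J)
  have hc : ∀ b : Fin 4, μ ::ₘ b ::ₘ b ::ₘ J = b ::ₘ b ::ₘ μ ::ₘ J := fun b => by
    rw [Multiset.cons_swap μ b, Multiset.cons_swap μ b]
  have h5 : ∀ K, SuperPoly.gen JetVar.odd onShell (y, K) = jet y K := fun K => rfl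
  simp only [eta_sum] at h1 h2
  simp only [map_sum, map_smul, FreeAlgebra.lift_ι_apply, eta_sum]
  ext i j
  fin_cases i <;> fin_cases j <;>
    simp [derivMatrix, formalDerivVar, koszul, hc, h1, h2, h5]

/-- The formal derivative `d_μ`, an even derivation of `𝒫`. -/
def formalDeriv (μ : Fin 4) : P →ₗ[ℂ] P :=
  SuperPoly.derivation JetVar.odd onShell false (formalDerivVar μ)
    (formalDerivVar_swap μ) (formalDerivVar_rel μ)

theorem formalDeriv_jet (μ : Fin 4) (y : FieldName) (J : Multiset (Fin 4)) :
    formalDeriv μ (jet y J) = jet y (μ ::ₘ J) :=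
  SuperPoly.derivation_gen _ _ _ _ _ _ _

theorem formalDeriv_one (μ : Fin 4) : formalDeriv μ 1 = 0 :=
  SuperPoly.derivation_one _ _ _ _ _ _

theorem formalDeriv_jet_mul (μ : Fin 4) (y : FieldName) (J : Multiset (Fin 4)) (b : P) :
    formalDeriv μ (jet y J * b) = jet y (μ ::ₘ J) * b + jet y J * formalDeriv μ b := by
  have h := SuperPoly.derivation_gen_mul JetVar.odd onShell false (formalDerivVar μ)
    (formalDerivVar_swap μ) (formalDerivVar_rel μ) (y, J) b
  simp only [koszul, Bool.false_and, Bool.false_eq_true, if_false, one_smul] at h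
  exact h

theorem formalDeriv_B (μ : Fin 4) (J : Multiset (Fin 4)) : formalDeriv μ (B J) = B (μ ::ₘ J) := by
  simp only [B, map_sum, map_smul, formalDeriv_jet, Multiset.cons_swap μ]

/-- The value of `d_Q` on the variables: `d_Q v_{μ;J} = i u_{;μJ}`, `d_Q u_{;J} = 0`,
`d_Q ũ_{;J} = -i B_{;J}`. These are forced by the values on `v_μ`, `u`, `ũ` and by
`[d_Q, d_μ] = 0`. -/
def dQVar : JetVar → P
  | (.v μ, J) => Complex.I • jet .u (μ ::ₘ J)
  | (.u, _) => 0
  | (.uTilde, J) => -(Complex.I • B J)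

theorem dQVar_swap (x y : JetVar) :
    derivMatrix JetVar.odd onShell true dQVar x * derivMatrix JetVar.odd onShell true dQVar y =
      koszul x.odd y.odd • (derivMatrix JetVar.odd onShell true dQVar y *
        derivMatrix JetVar.odd onShell true dQVar x) :=
  derivMatrix_swap _ _ _ _ (by
    rintro ⟨x, J⟩ ⟨y, K⟩
    change dQVar (x, J) * jet y K = _ • (jet y K * dQVar (x, J))
    cases x with
    | v μ =>
      simp [dQVar, JetVar.odd, FieldName.odd, jet_mul_jet .u y, smul_comm Complex.I]
    | u => simp [dQVar]
    | uTilde => simp [dQVar, jet_mul_B, JetVar.odd, FieldName.odd, koszul]) x y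

theorem dQVar_rel (r : FreeAlgebra ℂ JetVar) (hr : r ∈ onShell) :
    FreeAlgebra.lift ℂ (derivMatrix JetVar.odd onShell true dQVar) r = 0 := by
  obtain ⟨y, J, rfl⟩ := hr
  have h1 := jet_onShell y J
  have h2 := B_onShell J
  have h3 := fun μ => jet_onShell .u (μ ::ₘ J)
  have hc : ∀ μ b : Fin 4, b ::ₘ b ::ₘ μ ::ₘ J = μ ::ₘ b ::ₘ b ::ₘ J := fun μ b => by
    rw [Multiset.cons_swap μ b, Multiset.cons_swap μ b]
  simp only [eta_sum, hc] at h1 h2 h3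
  have h4 : dQVar (y, 0 ::ₘ 0 ::ₘ J) - dQVar (y, 1 ::ₘ 1 ::ₘ J) - dQVar (y, 2 ::ₘ 2 ::ₘ J)
      - dQVar (y, 3 ::ₘ 3 ::ₘ J) = 0 := by
    cases y with
    | v μ => simp only [dQVar, ← smul_sub, h3, smul_zero]
    | u => simp [dQVar]
    | uTilde =>
      simp only [dQVar]
      linear_combination (norm := module) (-Complex.I) • h2
  have h5 : ∀ K, SuperPoly.gen JetVar.odd onShell (y, K) = jet y K := fun K => rfl
  simp only [map_sum, map_smul, FreeAlgebra.lift_ι_apply, eta_sum]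
  ext i j
  fin_cases i <;> fin_cases j <;>
    simp [derivMatrix, JetVar.odd, ← smul_sub, h1, h4, h5]

/-- The differential `d_Q`, an odd derivation of `𝒫`. -/
def dQ : P →ₗ[ℂ] P :=
  SuperPoly.derivation JetVar.odd onShell true dQVar dQVar_swap dQVar_rel

theorem dQ_jet (y : FieldName) (J : Multiset (Fin 4)) : dQ (jet y J) = dQVar (y, J) :=
  SuperPoly.derivation_gen _ _ _ _ _ _ _

theorem dQ_one : dQ 1 = 0 := SuperPoly.derivation_one _ _ _ _ _ _

theorem dQ_jet_mul (y : FieldName) (J : Multiset (Fin 4)) (b : P) :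
    dQ (jet y J * b) = dQVar (y, J) * b + koszul true y.odd • (jet y J * dQ b) :=
  SuperPoly.derivation_gen_mul _ _ _ _ _ _ _ _

theorem dQ_dQVar_mul (y : FieldName) (J : Multiset (Fin 4)) (b : P) :
    dQ (dQVar (y, J) * b) = -koszul true y.odd • (dQVar (y, J) * dQ b) := by
  cases y with
  | v μ => simp [dQVar, dQ_jet_mul, koszul, FieldName.odd]
  | u => simp [dQVar]
  | uTilde =>
    have h := jet_onShell .u J
    simp only [eta_sum] at h
    have h' : dQ (B J * b) = B J * dQ b := by
      simp only [B, eta_sum, sub_mul, map_sub, dQ_jet_mul]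
      have h6 := congrArg (fun z => Complex.I • (z * b)) h
      simp only [sub_mul, zero_mul, smul_zero, smul_sub] at h6
      simp only [dQVar, koszul, FieldName.odd, Bool.and_false, Bool.false_eq_true, if_false,
        one_smul, smul_mul_assoc]
      linear_combination (norm := abel) h6
    simp [dQVar, koszul, FieldName.odd, h']

theorem dQ_dQ (p : P) : dQ (dQ p) = 0 := by
  induction p using SuperPoly.induction with
  | one => simp [dQ_one]
  | gen_mul x b hb =>
    change dQ (dQ (jet x.1 x.2 * b)) = 0
    rw [dQ_jet_mul, map_add, dQ_dQVar_mul, map_smul, dQ_jet_mul, hb]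
    simp
  | add a b ha hb => simp [ha, hb]
  | smul c a ha => simp [ha]

/-- `[d_Q, d_μ] = 0`. -/
theorem dQ_formalDeriv (μ : Fin 4) (p : P) : dQ (formalDeriv μ p) = formalDeriv μ (dQ p) := by
  induction p using SuperPoly.induction with
  | one => simp [dQ_one, formalDeriv_one]
  | gen_mul x b hb =>
    obtain ⟨y, J⟩ := x
    change dQ (formalDeriv μ (jet y J * b)) = formalDeriv μ (dQ (jet y J * b))
    have h : formalDeriv μ (dQVar (y, J) * b) =
        dQVar (y, μ ::ₘ J) * b + dQVar (y, J) * formalDeriv μ b := by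
      cases y with
      | v ν => simp [dQVar, formalDeriv_jet_mul, Multiset.cons_swap μ ν]
      | u => simp [dQVar]
      | uTilde =>
        simp only [dQVar, neg_mul, smul_mul_assoc, map_neg, map_smul]
        rw [← neg_add, ← smul_add]
        congr 2
        simp only [B, eta_sum, sub_mul, map_sub, formalDeriv_jet_mul, Multiset.cons_swap μ]
        abel
    rw [formalDeriv_jet_mul, map_add, dQ_jet_mul, dQ_jet_mul, dQ_jet_mul, map_add, map_smul, h,
      formalDeriv_jet_mul, hb, smul_add]
    abel
  | add a b ha hb => simp [ha, hb]
  | smul c a ha => simp [ha]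

/-- The cocycles `Z_Q`. -/
def ZQ : Submodule ℂ P := LinearMap.ker dQ

/-- The coboundaries `B_Q`. -/
def BQ : Submodule ℂ P := LinearMap.range dQ

/-- The coboundaries are cocycles. -/
theorem BQ_le_ZQ : BQ ≤ ZQ := by
  rintro _ ⟨p, rfl⟩
  exact dQ_dQ p

/-- The cohomology `H_Q = Z_Q / B_Q`. -/
abbrev HQ : Type := ZQ ⧸ BQ.submoduleOf ZQ

/-- The cohomology class of a cocycle. -/
def HQ.mk : ZQ →ₗ[ℂ] HQ := (BQ.submoduleOf ZQ).mkQ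

/-! ### The traceless field strengths -/

/-- `F_{μν;J}`, the derivatives of the field strength `F_{μν} = v_{ν;μ} - v_{μ;ν}`. -/
def F (μ ν : Fin 4) (J : Multiset (Fin 4)) : P := jet (.v ν) (μ ::ₘ J) - jet (.v μ) (ν ::ₘ J)

/-- The sum over `l` of `η_{μρ_l} B_{;νρ₁…ρ̂_l…ρₙ} - η_{νρ_l} B_{;μρ₁…ρ̂_l…ρₙ}`. -/
def traceTerm (μ ν : Fin 4) (J : Multiset (Fin 4)) : P :=
  (J.map fun ρ => eta μ ρ • B (ν ::ₘ J.erase ρ) - eta ν ρ • B (μ ::ₘ J.erase ρ)).sum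

/-- The traceless part `F⁽⁰⁾_{μν;ρ₁…ρₙ}` of `F_{μν;ρ₁…ρₙ}`: one adds `1 / (n + 2)` times
`∑_l (η_{μρ_l} B_{;νρ₁…ρ̂_l…ρₙ} - η_{νρ_l} B_{;μρ₁…ρ̂_l…ρₙ})`. -/
def F0 (μ ν : Fin 4) (J : Multiset (Fin 4)) : P :=
  F μ ν J + (1 / ((J.card : ℂ) + 2)) • traceTerm μ ν J

theorem traceTerm_cons (μ ν ρ : Fin 4) (J : Multiset (Fin 4)) :
    traceTerm μ ν (ρ ::ₘ J) = (eta μ ρ • B (ν ::ₘ J) - eta ν ρ • B (μ ::ₘ J)) +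
      (J.map fun τ => eta μ τ • B (ν ::ₘ ρ ::ₘ J.erase τ) -
        eta ν τ • B (μ ::ₘ ρ ::ₘ J.erase τ)).sum := by
  rw [traceTerm, Multiset.map_cons, Multiset.sum_cons, Multiset.erase_cons_head]
  congr 2
  refine Multiset.map_congr rfl fun τ hτ => ?_
  rw [Multiset.erase_cons_tail_of_mem hτ]

theorem F0_antisymm (μ ν : Fin 4) (J : Multiset (Fin 4)) : F0 μ ν J + F0 ν μ J = 0 := by
  have h : traceTerm μ ν J + traceTerm ν μ J = 0 := by
    rw [traceTerm, traceTerm, ← Multiset.sum_map_add]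
    simp
  rw [F0, F0, F, F]
  linear_combination (norm := module) (1 / ((J.card : ℂ) + 2)) • h

theorem traceTerm_trace_deriv (μ ν : Fin 4) (J : Multiset (Fin 4)) :
    ∑ ρ, ∑ σ, eta ρ σ • traceTerm μ ν (ρ ::ₘ σ ::ₘ J) = 0 := by
  have h : ∀ ρ, traceTerm μ ν (ρ ::ₘ ρ ::ₘ J) =
      (2 : ℂ) • (eta μ ρ • B (ν ::ₘ ρ ::ₘ J) - eta ν ρ • B (μ ::ₘ ρ ::ₘ J)) +
      (J.map fun τ => eta μ τ • B (ρ ::ₘ ρ ::ₘ ν ::ₘ J.erase τ) -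
        eta ν τ • B (ρ ::ₘ ρ ::ₘ μ ::ₘ J.erase τ)).sum := fun ρ => by
    have hm : ∀ τ ∈ J, eta μ τ • B (ν ::ₘ ρ ::ₘ (ρ ::ₘ J).erase τ) -
        eta ν τ • B (μ ::ₘ ρ ::ₘ (ρ ::ₘ J).erase τ) =
        eta μ τ • B (ρ ::ₘ ρ ::ₘ ν ::ₘ J.erase τ) -
        eta ν τ • B (ρ ::ₘ ρ ::ₘ μ ::ₘ J.erase τ) := fun τ hτ => by
      rw [Multiset.erase_cons_tail_of_mem hτ, Multiset.cons_swap ν ρ, Multiset.cons_swap ν ρ,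
        Multiset.cons_swap μ ρ, Multiset.cons_swap μ ρ]
    rw [traceTerm_cons, Multiset.map_cons, Multiset.sum_cons, Multiset.erase_cons_head,
      Multiset.map_congr rfl hm]
    module
  have h0 := fun K => B_onShell K
  simp only [eta_sum] at h0 ⊢
  have hs : ∀ K : Multiset (Fin 4), (K.map fun τ =>
      ((eta μ τ • B (0 ::ₘ 0 ::ₘ ν ::ₘ J.erase τ) - eta ν τ • B (0 ::ₘ 0 ::ₘ μ ::ₘ J.erase τ)))).sum
      - (K.map fun τ => ((eta μ τ • B (1 ::ₘ 1 ::ₘ ν ::ₘ J.erase τ)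
        - eta ν τ • B (1 ::ₘ 1 ::ₘ μ ::ₘ J.erase τ)))).sum
      - (K.map fun τ => ((eta μ τ • B (2 ::ₘ 2 ::ₘ ν ::ₘ J.erase τ)
        - eta ν τ • B (2 ::ₘ 2 ::ₘ μ ::ₘ J.erase τ)))).sum
      - (K.map fun τ => ((eta μ τ • B (3 ::ₘ 3 ::ₘ ν ::ₘ J.erase τ)
        - eta ν τ • B (3 ::ₘ 3 ::ₘ μ ::ₘ J.erase τ)))).sum = 0 := fun K => by
    rw [← Multiset.sum_map_sub, ← Multiset.sum_map_sub, ← Multiset.sum_map_sub]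
    refine Multiset.sum_eq_zero fun z hz => ?_
    obtain ⟨τ, -, rfl⟩ := Multiset.mem_map.1 hz
    linear_combination (norm := module)
      eta μ τ • h0 (ν ::ₘ J.erase τ) - eta ν τ • h0 (μ ::ₘ J.erase τ)
  have hd : (eta μ 0 • B (ν ::ₘ 0 ::ₘ J) - eta ν 0 • B (μ ::ₘ 0 ::ₘ J))
      - (eta μ 1 • B (ν ::ₘ 1 ::ₘ J) - eta ν 1 • B (μ ::ₘ 1 ::ₘ J))
      - (eta μ 2 • B (ν ::ₘ 2 ::ₘ J) - eta ν 2 • B (μ ::ₘ 2 ::ₘ J))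
      - (eta μ 3 • B (ν ::ₘ 3 ::ₘ J) - eta ν 3 • B (μ ::ₘ 3 ::ₘ J)) = 0 := by
    have hc := Multiset.cons_swap μ ν J
    fin_cases μ <;> fin_cases ν <;> simp [eta] at hc ⊢ <;> simp [hc]
  simp only [h]
  linear_combination (norm := module) (2 : ℂ) • hd + hs J

theorem F0_trace_deriv (μ ν : Fin 4) (J : Multiset (Fin 4)) :
    ∑ ρ, ∑ σ, eta ρ σ • F0 μ ν (ρ ::ₘ σ ::ₘ J) = 0 := by
  have h1 := traceTerm_trace_deriv μ ν J
  have h2 := jet_onShell (.v ν) (μ ::ₘ J)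
  have h3 := jet_onShell (.v μ) (ν ::ₘ J)
  have hc : ∀ a b : Fin 4, a ::ₘ b ::ₘ b ::ₘ J = b ::ₘ b ::ₘ a ::ₘ J := fun a b => by
    rw [Multiset.cons_swap a b, Multiset.cons_swap a b]
  simp only [eta_sum, F0, F, Multiset.card_cons, hc μ, hc ν] at h1 h2 h3 ⊢
  linear_combination (norm := module) h2 - h3 + (1 / (((J.card + 1 + 1 : ℕ) : ℂ) + 2)) • h1

theorem traceTerm_trace (ν : Fin 4) (J : Multiset (Fin 4)) :
    ∑ μ, ∑ ρ, eta μ ρ • traceTerm μ ν (ρ ::ₘ J) = ((J.card : ℂ) + 3) • B (ν ::ₘ J) := by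
  have h0 := fun K => B_onShell K
  simp only [eta_sum, traceTerm_cons] at h0 ⊢
  have hs : (J.map fun τ => eta 0 τ • B (ν ::ₘ 0 ::ₘ J.erase τ)
        - eta ν τ • B (0 ::ₘ 0 ::ₘ J.erase τ)).sum
      - (J.map fun τ => eta 1 τ • B (ν ::ₘ 1 ::ₘ J.erase τ)
        - eta ν τ • B (1 ::ₘ 1 ::ₘ J.erase τ)).sum
      - (J.map fun τ => eta 2 τ • B (ν ::ₘ 2 ::ₘ J.erase τ)
        - eta ν τ • B (2 ::ₘ 2 ::ₘ J.erase τ)).sum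
      - (J.map fun τ => eta 3 τ • B (ν ::ₘ 3 ::ₘ J.erase τ)
        - eta ν τ • B (3 ::ₘ 3 ::ₘ J.erase τ)).sum = (J.card : ℂ) • B (ν ::ₘ J) := by
    rw [← Multiset.sum_map_sub, ← Multiset.sum_map_sub, ← Multiset.sum_map_sub,
      Multiset.map_congr (g := fun _ => B (ν ::ₘ J)) rfl, Multiset.map_const', Multiset.sum_replicate,
      Nat.cast_smul_eq_nsmul]
    intro τ hτ
    have h1 : eta 0 τ • B (ν ::ₘ 0 ::ₘ J.erase τ) - eta 1 τ • B (ν ::ₘ 1 ::ₘ J.erase τ)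
        - eta 2 τ • B (ν ::ₘ 2 ::ₘ J.erase τ) - eta 3 τ • B (ν ::ₘ 3 ::ₘ J.erase τ)
        = B (ν ::ₘ J) := by
      conv_rhs => rw [← Multiset.cons_erase hτ]
      generalize J.erase τ = K
      fin_cases τ <;> simp [eta]
    linear_combination (norm := module) h1 - eta ν τ • h0 (J.erase τ)
  have hd : eta ν 0 • B (0 ::ₘ J) - eta ν 1 • B (1 ::ₘ J) - eta ν 2 • B (2 ::ₘ J)
      - eta ν 3 • B (3 ::ₘ J) = B (ν ::ₘ J) := by
    fin_cases ν <;> simp [eta]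
  have he : eta 0 0 = 1 ∧ eta 1 1 = -1 ∧ eta 2 2 = -1 ∧ eta 3 3 = -1 := by simp [eta]
  rw [he.1, he.2.1, he.2.2.1, he.2.2.2]
  linear_combination (norm := module) hs - hd

theorem F0_trace (ν : Fin 4) (J : Multiset (Fin 4)) :
    ∑ μ, ∑ ρ, eta μ ρ • F0 μ ν (ρ ::ₘ J) = 0 := by
  have h1 := traceTerm_trace ν J
  have h2 := jet_onShell (.v ν) J
  have hn : (J.card : ℂ) + 3 ≠ 0 := by exact_mod_cast (by omega : J.card + 3 ≠ 0)
  have h3 : (1 / (((J.card + 1 : ℕ) : ℂ) + 2)) * ((J.card : ℂ) + 3) = 1 := by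
    push_cast
    rw [add_assoc, show (1 + 2 : ℂ) = 3 by norm_num]
    field_simp
  have h4 : B (ν ::ₘ J) = jet (.v 0) (ν ::ₘ 0 ::ₘ J) - jet (.v 1) (ν ::ₘ 1 ::ₘ J)
      - jet (.v 2) (ν ::ₘ 2 ::ₘ J) - jet (.v 3) (ν ::ₘ 3 ::ₘ J) := by
    simp only [B, eta_sum, Multiset.cons_swap ν]
  have h5 := congrArg (fun z => (1 / (((J.card + 1 : ℕ) : ℂ) + 2)) • z) h1
  simp only [smul_smul, h3, one_smul] at h5
  simp only [eta_sum, F0, F, Multiset.card_cons] at h2 h5 ⊢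
  linear_combination (norm := module) h2 + h5 + h4

theorem F0_bianchi (μ ν ρ : Fin 4) (J : Multiset (Fin 4)) :
    F0 μ ν (ρ ::ₘ J) + F0 ν ρ (μ ::ₘ J) + F0 ρ μ (ν ::ₘ J) = 0 := by
  have hη : ∀ a b, eta a b = eta b a := fun a b => by
    unfold eta
    by_cases h : a = b <;> simp [h, eq_comm]
  have h : traceTerm μ ν (ρ ::ₘ J) + traceTerm ν ρ (μ ::ₘ J) + traceTerm ρ μ (ν ::ₘ J) = 0 := by
    have hs : (J.map fun τ => eta μ τ • B (ν ::ₘ ρ ::ₘ J.erase τ)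
          - eta ν τ • B (μ ::ₘ ρ ::ₘ J.erase τ)).sum
        + (J.map fun τ => eta ν τ • B (ρ ::ₘ μ ::ₘ J.erase τ)
          - eta ρ τ • B (ν ::ₘ μ ::ₘ J.erase τ)).sum
        + (J.map fun τ => eta ρ τ • B (μ ::ₘ ν ::ₘ J.erase τ)
          - eta μ τ • B (ρ ::ₘ ν ::ₘ J.erase τ)).sum = 0 := by
      rw [← Multiset.sum_map_add, ← Multiset.sum_map_add]
      refine Multiset.sum_eq_zero fun z hz => ?_
      obtain ⟨τ, -, rfl⟩ := Multiset.mem_map.1 hz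
      rw [Multiset.cons_swap ν ρ, Multiset.cons_swap μ ρ, Multiset.cons_swap μ ν]
      abel
    simp only [traceTerm_cons]
    rw [hη ν μ, hη ρ μ, hη ρ ν]
    linear_combination (norm := abel) hs
  simp only [F0, F, Multiset.card_cons]
  rw [Multiset.cons_swap μ ρ, Multiset.cons_swap ν ρ, Multiset.cons_swap ν μ]
  linear_combination (norm := module) (1 / (((J.card + 1 : ℕ) : ℂ) + 2)) • h

theorem dQ_B (J : Multiset (Fin 4)) : dQ (B J) = 0 := by
  have h := jet_onShell .u J
  simp only [eta_sum] at h
  simp only [B, eta_sum, map_sub, dQ_jet, dQVar]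
  linear_combination (norm := module) Complex.I • h

theorem dQ_F0 (μ ν : Fin 4) (J : Multiset (Fin 4)) : dQ (F0 μ ν J) = 0 := by
  have h : dQ (traceTerm μ ν J) = 0 := by
    rw [traceTerm, map_multiset_sum, Multiset.map_map]
    refine Multiset.sum_eq_zero fun z hz => ?_
    obtain ⟨τ, -, rfl⟩ := Multiset.mem_map.1 hz
    simp [dQ_B]
  simp [F0, F, dQ_jet, dQVar, h, Multiset.cons_swap μ ν]

theorem jet_mul_F0 (y : FieldName) (K : Multiset (Fin 4)) (μ ν : Fin 4) (J : Multiset (Fin 4)) :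
    jet y K * F0 μ ν J = F0 μ ν J * jet y K := by
  have h : jet y K * traceTerm μ ν J = traceTerm μ ν J * jet y K := by
    rw [traceTerm, ← Multiset.sum_map_mul_left, ← Multiset.sum_map_mul_right]
    simp [mul_sub, sub_mul, jet_mul_B]
  simp [F0, F, mul_add, add_mul, mul_sub, sub_mul, h, jet_mul_jet y (.v _), koszul, FieldName.odd]

theorem F0_mul_F0 (μ ν : Fin 4) (J : Multiset (Fin 4)) (μ' ν' : Fin 4) (J' : Multiset (Fin 4)) :
    F0 μ ν J * F0 μ' ν' J' = F0 μ' ν' J' * F0 μ ν J := by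
  have hB : ∀ K, B K * F0 μ' ν' J' = F0 μ' ν' J' * B K := fun K => by
    simp [B, eta_sum, sub_mul, mul_sub, jet_mul_F0]
  have h : traceTerm μ ν J * F0 μ' ν' J' = F0 μ' ν' J' * traceTerm μ ν J := by
    rw [traceTerm, ← Multiset.sum_map_mul_left, ← Multiset.sum_map_mul_right]
    simp [mul_sub, sub_mul, hB]
  rw [F0, add_mul, mul_add, F, sub_mul, mul_sub, jet_mul_F0, jet_mul_F0, smul_mul_assoc, h,
    mul_smul_comm]

/-- The subspace `𝒫₀ ⊂ 𝒫` of polynomials in `u` and the `F⁽⁰⁾_{μν;ρ₁…ρₙ}`. -/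
def P0 : Subalgebra ℂ P :=
  Algebra.adjoin ℂ ({jet .u 0} ∪ {x | ∃ μ ν J, x = F0 μ ν J})

/-! ### Polynomials in `u` and a traceless tensor, and the Bianchi identities -/

/-- The variables `u` and `F⁽⁰⁾_{μν;J}`, as formal symbols. -/
inductive PhysVar
  | u
  | F0 (μ ν : Fin 4) (J : Multiset (Fin 4))

def PhysVar.odd : PhysVar → Bool
  | .u => true
  | .F0 _ _ _ => false

/-- `F⁽⁰⁾_{μν;ρ₁…ρₙ}` is antisymmetric in `μ, ν` and traceless in all indices; the symmetry in
the `ρ`s is built into the multiset `J`. -/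
inductive TracelessRelator : FreeAlgebra ℂ PhysVar → Prop
  | antisymm (μ ν : Fin 4) (J : Multiset (Fin 4)) : TracelessRelator
      (FreeAlgebra.ι ℂ (PhysVar.F0 μ ν J) + FreeAlgebra.ι ℂ (PhysVar.F0 ν μ J))
  | trace_deriv (μ ν : Fin 4) (J : Multiset (Fin 4)) : TracelessRelator
      (∑ ρ, ∑ σ, eta ρ σ • FreeAlgebra.ι ℂ (PhysVar.F0 μ ν (ρ ::ₘ σ ::ₘ J)))
  | trace (ν : Fin 4) (J : Multiset (Fin 4)) : TracelessRelator
      (∑ μ, ∑ ρ, eta μ ρ • FreeAlgebra.ι ℂ (PhysVar.F0 μ ν (ρ ::ₘ J)))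

/-- The polynomials in the formal variables `u` and `F⁽⁰⁾_{μν;J}`. -/
abbrev FormalP0 : Type := SuperPoly PhysVar.odd {r | TracelessRelator r}

/-- A variable of `FormalP0`. -/
def physGen (x : PhysVar) : FormalP0 := SuperPoly.gen PhysVar.odd {r | TracelessRelator r} x

/-- The value in `𝒫` of the formal variables. -/
def evalVar : PhysVar → P
  | .u => jet .u 0
  | .F0 μ ν J => F0 μ ν J

/-- The canonical map from the formal polynomials in `u` and `F⁽⁰⁾_{μν;J}` to `𝒫`. -/
def evalP0 : FormalP0 →ₐ[ℂ] P :=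
  SuperPoly.lift PhysVar.odd {r | TracelessRelator r} evalVar
    (by
      intro x y
      cases x <;> cases y
      · exact jet_mul_jet _ _ _ _
      · simpa [koszul, evalVar, PhysVar.odd] using jet_mul_F0 _ _ _ _ _
      · simpa [koszul, evalVar, PhysVar.odd] using (jet_mul_F0 _ _ _ _ _).symm
      · simpa [koszul, evalVar, PhysVar.odd] using F0_mul_F0 _ _ _ _ _ _)
    (by
      intro r hr
      cases hr with
      | antisymm μ ν J => simpa [evalVar] using F0_antisymm μ ν J
      | trace_deriv μ ν J => simpa [evalVar] using F0_trace_deriv μ ν J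
      | trace ν J => simpa [evalVar] using F0_trace ν J)

theorem evalP0_physGen (x : PhysVar) : evalP0 (physGen x) = evalVar x :=
  SuperPoly.lift_gen _ _ _ _ _ _

/-- The Bianchi identities. -/
inductive BianchiRel : FormalP0 → FormalP0 → Prop
  | bianchi (μ ν ρ : Fin 4) (J : Multiset (Fin 4)) : BianchiRel
      (physGen (.F0 μ ν (ρ ::ₘ J)) + physGen (.F0 ν ρ (μ ::ₘ J)) + physGen (.F0 ρ μ (ν ::ₘ J))) 0

/-- The polynomials in `u` and `F⁽⁰⁾_{μν;J}`, factorized to the ideal generated by the Bianchi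
identities. -/
def ReducedP0 : Type := RingQuot BianchiRel

instance : Ring ReducedP0 := inferInstanceAs (Ring (RingQuot BianchiRel))

instance : Algebra ℂ ReducedP0 := inferInstanceAs (Algebra ℂ (RingQuot BianchiRel))

/-- The projection to the factor space. -/
def ReducedP0.mk : FormalP0 →ₐ[ℂ] ReducedP0 := RingQuot.mkAlgHom ℂ BianchiRel

end

end GaugeCohomology

/-!
On the linear span of the jets, `d_Q` is contracted by an odd map `h` which sends `ũ` to `0`,
`v_{σ;J}` to a combination of jets of `ũ` and `u_{;J}` to a combination of jets of `v`, with
coefficients chosen such that `h` respects the field equations. Extend `h` to an odd derivation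
of `𝒫`. Then `L = d_Q h + h d_Q` is an even derivation commuting with `d_Q`, and on the linear span
of the jets it is `1` minus the projection to the span of `u` and the `F⁽⁰⁾_{μν;J}`. Hence `𝒫` is
spanned by `𝒫₀`, on which `L` vanishes, and the eigenspaces of `L` to positive integers. A cocycle
`p` with `L p = n p` and `n ≥ 1` is the coboundary `d_Q (h p / n)`, so `𝒫₀` represents all of the
cohomology.

There are no further relations: the potential `v` of a traceless curl-free `F` can be chosen by the
formula of the Poincaré lemma, and this choice defines an algebra homomorphism from `𝒫` back to
`𝒫̂₀ / 𝓘` which kills `d_Q` of everything and is a left inverse of the natural map.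
-/

namespace GaugeCohomology

noncomputable section

section TwistedDerivation

variable {R A A' A'' : Type*} [CommRing R] [Ring A] [Ring A'] [Ring A''] [Algebra R A]
  [Algebra R A'] [Algebra R A'']

/-- A linear map `D` with `D (a * b) = D a * β b + α a * D b`. For `α` the parity automorphism and
`β` the identity these are the odd derivations, for `α` and `β` both the identity the even ones. -/
structure IsTwistedDerivation (α β : A →ₐ[R] A') (D : A →ₗ[R] A') : Prop where
  map_mul (a b : A) : D (a * b) = D a * β b + α a * D b

namespace IsTwistedDerivation

variable {α β : A →ₐ[R] A'} {D D' : A →ₗ[R] A'}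

theorem add (hD : IsTwistedDerivation α β D) (hD' : IsTwistedDerivation α β D') :
    IsTwistedDerivation α β (D + D') where
  map_mul a b := by
    simp only [LinearMap.add_apply, hD.map_mul, hD'.map_mul]
    noncomm_ring

theorem algHom_comp (hD : IsTwistedDerivation α β D) (f : A' →ₐ[R] A'') :
    IsTwistedDerivation (f.comp α) (f.comp β) (f.toLinearMap ∘ₗ D) where
  map_mul a b := by simp [hD.map_mul]

theorem comp_algHom (hD : IsTwistedDerivation α β D) (f : A'' →ₐ[R] A) :
    IsTwistedDerivation (α.comp f) (β.comp f) (D ∘ₗ f.toLinearMap) where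
  map_mul a b := by simp [hD.map_mul]

theorem map_one (hD : IsTwistedDerivation α β D) : D 1 = 0 := by
  simpa using hD.map_mul 1 1

theorem adjoin_le_ker (hD : IsTwistedDerivation α β D) {s : Set A} (hs : ∀ x ∈ s, D x = 0) :
    Subalgebra.toSubmodule (Algebra.adjoin R s) ≤ LinearMap.ker D := fun x hx => by
  rw [LinearMap.mem_ker]
  induction hx using Algebra.adjoin_induction with
  | mem x hx => exact hs x hx
  | algebraMap r => rw [Algebra.algebraMap_eq_smul_one, map_smul, hD.map_one, smul_zero]
  | add x y _ _ hx hy => rw [map_add, hx, hy, add_zero]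
  | mul x y _ _ hx hy => rw [hD.map_mul, hx, hy, zero_mul, mul_zero, add_zero]

theorem eq_zero_of_adjoin_eq_top (hD : IsTwistedDerivation α β D) {s : Set A}
    (hs : Algebra.adjoin R s = ⊤) (h : ∀ x ∈ s, D x = 0) : D = 0 :=
  LinearMap.ker_eq_top.mp (top_le_iff.mp (by simpa [hs] using hD.adjoin_le_ker h))

theorem anticommutator {σ : A →ₐ[R] A} {D D' : A →ₗ[R] A}
    (hD : IsTwistedDerivation σ (.id R A) D) (hD' : IsTwistedDerivation σ (.id R A) D')
    (hσD : σ.toLinearMap ∘ₗ D + D ∘ₗ σ.toLinearMap = 0)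
    (hσD' : σ.toLinearMap ∘ₗ D' + D' ∘ₗ σ.toLinearMap = 0) :
    IsTwistedDerivation (σ.comp σ) (.id R A) (D ∘ₗ D' + D' ∘ₗ D) where
  map_mul a b := by
    have h : σ (D a) + D (σ a) = 0 := LinearMap.congr_fun hσD a
    have h' : σ (D' a) + D' (σ a) = 0 := LinearMap.congr_fun hσD' a
    simp only [LinearMap.add_apply, LinearMap.comp_apply, hD.map_mul, hD'.map_mul, map_add,
      AlgHom.id_apply, AlgHom.comp_apply]
    linear_combination (norm := noncomm_ring) h * D' b + h' * D b

end IsTwistedDerivation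

end TwistedDerivation

section PositivePart

variable {K V A : Type*} [Field K] [AddCommGroup V] [Module K V] [Ring A] [Algebra K A]

/-- The sum of the eigenspaces of an endomorphism for the eigenvalues `1, 2, 3, …`. -/
def positivePart (L : Module.End K V) : Submodule K V :=
  ⨆ n : ℕ, L.eigenspace ((n + 1 : ℕ) : K)

theorem disjoint_ker_positivePart [CharZero K] (L : Module.End K V) :
    Disjoint (LinearMap.ker L) (positivePart L) := by
  rw [← L.eigenspace_zero]
  refine (L.eigenspaces_iSupIndep 0).mono_right (iSup_le fun n => ?_)
  exact le_biSup L.eigenspace (Nat.cast_ne_zero.mpr n.succ_ne_zero)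

theorem positivePart_le_map [CharZero K] (L : Module.End K V) :
    positivePart L ≤ (positivePart L).map L := by
  refine iSup_le fun n x hx => ⟨((n + 1 : ℕ) : K)⁻¹ • x, ?_, ?_⟩
  · exact Submodule.smul_mem _ _ (Submodule.mem_iSup_of_mem n hx)
  · rw [map_smul, Module.End.mem_eigenspace_iff.mp hx,
      inv_smul_smul₀ (Nat.cast_ne_zero.mpr n.succ_ne_zero)]

theorem map_positivePart_le {L d : Module.End K V} (h : Commute d L) :
    (positivePart L).map d ≤ positivePart L := by
  rw [positivePart, Submodule.map_iSup]
  refine iSup_mono fun n => ?_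
  rintro _ ⟨x, hx, rfl⟩
  rw [SetLike.mem_coe, Module.End.mem_eigenspace_iff] at hx
  rw [Module.End.mem_eigenspace_iff, ← Module.End.mul_apply, ← h.eq, Module.End.mul_apply, hx,
    map_smul]

/-- If `p = L r` with `r` in the positive part, then `L (d r) = d p`, so that `d p = 0` forces
`d r = 0` and `p = d (h r)`. -/
theorem ker_inf_positivePart_le_range [CharZero K] {d h : Module.End K V} (hd : d * d = 0) :
    LinearMap.ker d ⊓ positivePart (d * h + h * d) ≤ LinearMap.range d := by
  rintro p ⟨hp, hpos⟩
  obtain ⟨r, hr, rfl⟩ := positivePart_le_map _ hpos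
  have hcomm : Commute d (d * h + h * d) := by
    rw [Commute, SemiconjBy, mul_add, add_mul, ← mul_assoc, hd, mul_assoc h, hd]
    noncomm_ring
  have hdr : d r = 0 := by
    refine Submodule.disjoint_def.mp (disjoint_ker_positivePart (d * h + h * d)) _ ?_
      (map_positivePart_le hcomm ⟨r, hr, rfl⟩)
    rw [LinearMap.mem_ker, ← Module.End.mul_apply, ← hcomm.eq]
    exact hp
  exact ⟨h r, by simp [hdr]⟩

theorem ker_le_sup_range [CharZero K] {d h : Module.End K V} (hd : d * d = 0)
    {W : Submodule K V} (hW : W ≤ LinearMap.ker d) (htop : W ⊔ positivePart (d * h + h * d) = ⊤) :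
    LinearMap.ker d ≤ W ⊔ LinearMap.range d :=
  calc LinearMap.ker d = (W ⊔ positivePart (d * h + h * d)) ⊓ LinearMap.ker d := by
        rw [htop, top_inf_eq]
    _ = W ⊔ positivePart (d * h + h * d) ⊓ LinearMap.ker d := (sup_inf_assoc_of_le _ hW)
    _ ≤ W ⊔ LinearMap.range d := by
        rw [inf_comm]
        exact sup_le_sup_left (ker_inf_positivePart_le_range hd) W

variable {L : Module.End K A}

theorem eigenspace_mul_eigenspace_le (hL : IsTwistedDerivation (.id K A) (.id K A) L) (μ ν : K) :
    L.eigenspace μ * L.eigenspace ν ≤ L.eigenspace (μ + ν) := by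
  refine Submodule.mul_le.mpr fun a ha b hb => ?_
  rw [Module.End.mem_eigenspace_iff] at ha hb ⊢
  simp only [hL.map_mul, AlgHom.id_apply, ha, hb, smul_mul_assoc, mul_smul_comm, add_smul]

theorem positivePart_mul_positivePart_le (hL : IsTwistedDerivation (.id K A) (.id K A) L) :
    positivePart L * positivePart L ≤ positivePart L := by
  simp only [positivePart, Submodule.iSup_mul, Submodule.mul_iSup]
  refine iSup₂_le fun m n => (eigenspace_mul_eigenspace_le hL _ _).trans ?_
  refine le_iSup_of_le (m + n + 1) (le_of_eq ?_)
  congr 1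
  push_cast
  ring

theorem ker_mul_positivePart_le (hL : IsTwistedDerivation (.id K A) (.id K A) L) :
    LinearMap.ker L * positivePart L ≤ positivePart L := by
  simp only [positivePart, Submodule.mul_iSup, ← L.eigenspace_zero]
  exact iSup_mono fun n => (eigenspace_mul_eigenspace_le hL _ _).trans_eq (by rw [zero_add])

theorem positivePart_mul_ker_le (hL : IsTwistedDerivation (.id K A) (.id K A) L) :
    positivePart L * LinearMap.ker L ≤ positivePart L := by
  simp only [positivePart, Submodule.iSup_mul, ← L.eigenspace_zero]
  exact iSup_mono fun n => (eigenspace_mul_eigenspace_le hL _ _).trans_eq (by rw [add_zero])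

theorem sup_positivePart_eq_top (hL : IsTwistedDerivation (.id K A) (.id K A) L)
    {W : Subalgebra K A} (hW : Subalgebra.toSubmodule W ≤ LinearMap.ker L) {s : Set A}
    (hs : Algebra.adjoin K s = ⊤)
    (h : ∀ x ∈ s, x ∈ Subalgebra.toSubmodule W ⊔ L.eigenspace 1) :
    Subalgebra.toSubmodule W ⊔ positivePart L = ⊤ := by
  set M := Subalgebra.toSubmodule W ⊔ positivePart L with hM
  have hone : 1 ∈ M := Submodule.mem_sup_left W.one_mem
  have hmul : M * M ≤ M := by
    rw [hM, Submodule.sup_mul, Submodule.mul_sup, Submodule.mul_sup,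
      W.isIdempotentElem_toSubmodule.eq]
    refine sup_le (sup_le_sup_left ?_ _) (le_sup_of_le_right (sup_le ?_ ?_))
    · exact (mul_le_mul_left hW _).trans (ker_mul_positivePart_le hL)
    · exact (mul_le_mul_right hW _).trans (positivePart_mul_ker_le hL)
    · exact positivePart_mul_positivePart_le hL
  have hle : L.eigenspace 1 ≤ positivePart L := le_iSup_of_le 0 (by simp)
  have hadjoin : Algebra.adjoin K s ≤ M.toSubalgebra hone fun a b ha hb =>
      hmul (Submodule.mul_mem_mul ha hb) :=
    Algebra.adjoin_le fun x hx => sup_le_sup_left hle _ (h x hx)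
  exact eq_top_iff.mpr fun x _ => hadjoin (hs ▸ Algebra.mem_top)

end PositivePart

namespace SuperPoly

variable {ι : Type} {odd : ι → Bool} {R : Set (FreeAlgebra ℂ ι)}

theorem adjoin_range_gen : Algebra.adjoin ℂ (Set.range (gen odd R)) = ⊤ := by
  have h : Set.range (gen odd R) = mk odd R '' Set.range (FreeAlgebra.ι ℂ) := by
    rw [← Set.range_comp]
    rfl
  rw [h, ← AlgHom.map_adjoin, FreeAlgebra.adjoin_range_ι, Algebra.map_top,
    AlgHom.range_eq_top]
  exact mk_surjective odd R

theorem gen_mem_center {x : ι} (hx : odd x = false) :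
    gen odd R x ∈ Subalgebra.center ℂ (SuperPoly odd R) := by
  have h : Algebra.adjoin ℂ (Set.range (gen odd R)) ≤ Subalgebra.centralizer ℂ {gen odd R x} := by
    refine Algebra.adjoin_le ?_
    rintro _ ⟨y, rfl⟩
    rw [SetLike.mem_coe, Subalgebra.mem_centralizer_iff]
    rintro _ rfl
    simpa [koszul, hx] using gen_mul_gen odd R x y
  rw [adjoin_range_gen, top_le_iff] at h
  refine Subalgebra.mem_center_iff.mpr fun b => ?_
  have hb : b ∈ Subalgebra.centralizer ℂ {gen odd R x} := h ▸ Algebra.mem_top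
  exact ((Subalgebra.mem_centralizer_iff ℂ).mp hb _ rfl).symm

theorem isTwistedDerivation_derivation {k : Bool} {δ : ι → SuperPoly odd R}
    (hswap : ∀ x y, derivMatrix odd R k δ x * derivMatrix odd R k δ y =
      koszul (odd x) (odd y) • (derivMatrix odd R k δ y * derivMatrix odd R k δ x))
    (hrel : ∀ r ∈ R, FreeAlgebra.lift ℂ (derivMatrix odd R k δ) r = 0)
    {σ : SuperPoly odd R →ₐ[ℂ] SuperPoly odd R}
    (hσ : ∀ x, σ (gen odd R x) = koszul k (odd x) • gen odd R x) :
    IsTwistedDerivation σ (.id ℂ _) (derivation odd R k δ hswap hrel) where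
  map_mul a b := by
    induction a using SuperPoly.induction with
    | one => simp [derivation_one]
    | gen_mul x a ih =>
      simp only [mul_assoc, derivation_gen_mul, ih, map_mul, hσ, AlgHom.id_apply, mul_add, add_mul,
        smul_mul_assoc, smul_add, add_assoc]
    | add a a' ha ha' =>
      simp only [add_mul, map_add, ha, ha']
      abel
    | smul c a ha => simp only [smul_mul_assoc, map_smul, ha, smul_add]

end SuperPoly

/-! ### Symmetrization over multi-indices -/

section SumErase

variable {ι E E' : Type*} [DecidableEq ι] [AddCommMonoid E] [AddCommMonoid E']

/-- The sum of `G ρ K` over all ways to write `J = ρ ::ₘ K`, counted with multiplicity. If `G ρ K`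
is the coefficient of `x^K / K!` in a power series `g_ρ`, then this is the coefficient of
`x^J / J!` in `∑ ρ, x_ρ g_ρ`. -/
def sumErase (G : ι → Multiset ι → E) (J : Multiset ι) : E :=
  (J.map fun ρ => G ρ (J.erase ρ)).sum

theorem sumErase_empty (G : ι → Multiset ι → E) : sumErase G 0 = 0 := by
  simp [sumErase]

theorem sumErase_cons (G : ι → Multiset ι → E) (a : ι) (J : Multiset ι) :
    sumErase G (a ::ₘ J) = G a J + sumErase (fun ρ K => G ρ (a ::ₘ K)) J := by
  rw [sumErase, Multiset.map_cons, Multiset.sum_cons, Multiset.erase_cons_head, sumErase]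
  congr 2
  exact Multiset.map_congr rfl fun τ hτ => by rw [Multiset.erase_cons_tail_of_mem hτ]

theorem sumErase_congr {G G' : ι → Multiset ι → E} {J : Multiset ι}
    (h : ∀ ρ K, J = ρ ::ₘ K → G ρ K = G' ρ K) : sumErase G J = sumErase G' J :=
  congrArg Multiset.sum <| Multiset.map_congr rfl fun ρ hρ => h ρ _ (Multiset.cons_erase hρ).symm

theorem sumErase_zero : sumErase (fun (_ : ι) _ => (0 : E)) = fun _ => 0 :=
  funext fun J => by simp [sumErase]

theorem sumErase_add (G G' : ι → Multiset ι → E) (J : Multiset ι) :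
    sumErase (fun ρ K => G ρ K + G' ρ K) J = sumErase G J + sumErase G' J :=
  Multiset.sum_map_add

theorem sumErase_comm (G : ι → ι → Multiset ι → E) (J : Multiset ι) :
    sumErase (fun ρ => sumErase fun τ => G ρ τ) J =
      sumErase (fun ρ => sumErase fun τ => G τ ρ) J := by
  induction J using Multiset.induction generalizing G with
  | empty => simp only [sumErase_empty]
  | cons a J ih =>
    simp only [sumErase_cons, sumErase_add]
    rw [ih fun ρ τ L => G ρ τ (a ::ₘ L)]
    abel

theorem sumErase_sub {E : Type*} [AddCommGroup E] (G G' : ι → Multiset ι → E) (J : Multiset ι) :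
    sumErase (fun ρ K => G ρ K - G' ρ K) J = sumErase G J - sumErase G' J :=
  Multiset.sum_map_sub

theorem map_sumErase {F : Type*} [FunLike F E E'] [AddMonoidHomClass F E E'] (f : F)
    (G : ι → Multiset ι → E) (J : Multiset ι) :
    f (sumErase G J) = sumErase (fun ρ K => f (G ρ K)) J := by
  simp [sumErase, map_multiset_sum, Multiset.map_map]

theorem smul_sumErase {R : Type*} [Semiring R] [Module R E] (c : R) (G : ι → Multiset ι → E)
    (J : Multiset ι) : c • sumErase G J = sumErase (fun ρ K => c • G ρ K) J :=
  map_sumErase (DistribSMul.toAddMonoidHom E c) G J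

theorem sum_smul_sumErase {R κ : Type*} [Semiring R] [Module R E] (s : Finset κ) (c : κ → R)
    (G : κ → ι → Multiset ι → E) (J : Multiset ι) :
    ∑ a ∈ s, c a • sumErase (G a) J = sumErase (fun ρ K => ∑ a ∈ s, c a • G a ρ K) J := by
  simp only [sumErase, Multiset.smul_sum, Multiset.map_map, Function.comp_def]
  exact Multiset.sum_map_sum_map _ _

theorem sumErase_cons_self (f : Multiset ι → E) (J : Multiset ι) :
    sumErase (fun ρ K => f (ρ ::ₘ K)) J = J.card • f J := by
  rw [sumErase_congr (G' := fun _ _ => f J) fun ρ K h => by rw [h]]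
  simp [sumErase]

end SumErase

section Metric

variable {E E' : Type*} [AddCommGroup E] [Module ℂ E] [AddCommGroup E'] [Module ℂ E']

theorem eta_comm (a b : Fin 4) : eta a b = eta b a := by
  by_cases h : a = b <;> simp [eta, h, eq_comm]

theorem eta_mul_eta_self (a : Fin 4) : eta a a * eta a a = 1 := by
  fin_cases a <;> simp [eta]

theorem sum_sum_eta_smul (f : Fin 4 → Fin 4 → E) :
    ∑ ρ, ∑ σ, eta ρ σ • f ρ σ = ∑ a, eta a a • f a a := by
  simp [eta]

theorem sum_eta_smul_eta_smul (b : Fin 4) (f : Fin 4 → E) :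
    ∑ a, eta a a • eta a b • f a = f b := by
  rw [Finset.sum_eq_single b (fun a _ hab => by simp [eta, hab]) (by simp), smul_smul,
    eta_mul_eta_self, one_smul]

theorem sum_eta_smul_eta_smul_self (x : E) : ∑ a, eta a a • eta a a • x = (4 : ℂ) • x := by
  simp [smul_smul, eta_mul_eta_self, ← Nat.cast_smul_eq_nsmul ℂ]

/-- A family indexed by multi-indices all of whose traces vanish. -/
def IsTraceless (G : Multiset (Fin 4) → E) : Prop :=
  ∀ J, ∑ a, eta a a • G (a ::ₘ a ::ₘ J) = 0

/-- Multiplication by the quadratic form `x^ρ x_ρ`, in terms of coefficients of `x^J / J!`. -/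
def box (G : Multiset (Fin 4) → E) : Multiset (Fin 4) → E :=
  sumErase fun ρ => sumErase fun σ K => eta ρ σ • G K

/-- The contraction of `W ρ J` over `ρ` and one entry of `J`. -/
def divergence (W : Fin 4 → Multiset (Fin 4) → E) (J : Multiset (Fin 4)) : E :=
  ∑ a, eta a a • W a (a ::ₘ J)

/-- The traceless part of the symmetrization `sumErase W`, up to the factor `card J`, which keeps
the definition free of division. -/
def tracelessSym (W : Fin 4 → Multiset (Fin 4) → E) (J : Multiset (Fin 4)) : E :=
  (J.card : ℂ) • sumErase W J - (1 / 2 : ℂ) • box (divergence W) J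

theorem box_cons (G : Multiset (Fin 4) → E) (a : Fin 4) (J : Multiset (Fin 4)) :
    box G (a ::ₘ J) = (2 : ℂ) • sumErase (fun σ K => eta a σ • G K) J +
      box (fun K => G (a ::ₘ K)) J := by
  simp only [box, sumErase_cons, sumErase_add, eta_comm _ a]
  module

theorem map_box (f : E →ₗ[ℂ] E') (G : Multiset (Fin 4) → E) (J : Multiset (Fin 4)) :
    f (box G J) = box (fun K => f (G K)) J := by
  simp only [box, map_sumErase, map_smul]

theorem map_divergence (f : E →ₗ[ℂ] E') (W : Fin 4 → Multiset (Fin 4) → E)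
    (J : Multiset (Fin 4)) : f (divergence W J) = divergence (fun ρ K => f (W ρ K)) J := by
  simp only [divergence, map_sum, map_smul]

theorem map_tracelessSym (f : E →ₗ[ℂ] E') (W : Fin 4 → Multiset (Fin 4) → E)
    (J : Multiset (Fin 4)) : f (tracelessSym W J) = tracelessSym (fun ρ K => f (W ρ K)) J := by
  simp only [tracelessSym, map_sub, map_smul, map_sumErase, map_box, map_divergence]

theorem map_tracelessSym_congr {f g : E →ₗ[ℂ] E'} {W : Fin 4 → Multiset (Fin 4) → E}
    (h : ∀ ρ K, f (W ρ K) = g (W ρ K)) (J : Multiset (Fin 4)) :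
    f (tracelessSym W J) = g (tracelessSym W J) := by
  simp only [map_tracelessSym, h]

theorem divergence_eta_smul (G : Multiset (Fin 4) → E) (σ : Fin 4) :
    divergence (fun τ K => eta σ τ • G K) = fun J => G (σ ::ₘ J) :=
  funext fun J => by
    simpa only [divergence, eta_comm σ] using sum_eta_smul_eta_smul σ fun a => G (a ::ₘ J)

theorem sum_eta_smul_sumErase (G : Multiset (Fin 4) → E) (J : Multiset (Fin 4)) :
    ∑ a, eta a a • sumErase (fun σ K => eta a σ • G (a ::ₘ K)) J = (J.card : ℂ) • G J := by
  simp only [sum_smul_sumErase, sum_eta_smul_eta_smul, sumErase_cons_self, Nat.cast_smul_eq_nsmul]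

variable {G : Multiset (Fin 4) → E} {W : Fin 4 → Multiset (Fin 4) → E}

theorem IsTraceless.cons (hG : IsTraceless G) (b : Fin 4) :
    IsTraceless fun J => G (b ::ₘ J) := fun J => by
  simpa only [Multiset.cons_swap b] using hG (b ::ₘ J)

theorem IsTraceless.map (hG : IsTraceless G) (f : E →ₗ[ℂ] E') :
    IsTraceless fun J => f (G J) := fun J => by
  simpa only [map_sum, map_smul, map_zero] using congrArg f (hG J)

theorem IsTraceless.card_smul (hG : IsTraceless G) (c : ℕ → ℂ) :
    IsTraceless fun J => c J.card • G J := fun J => by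
  simp only [Multiset.card_cons, smul_comm (eta _ _), ← Finset.smul_sum, hG J, smul_zero]

theorem isTraceless_divergence (hW : ∀ ρ, IsTraceless (W ρ)) :
    IsTraceless (divergence W) := fun J => by
  simp only [divergence, Finset.smul_sum]
  rw [Finset.sum_comm]
  refine Finset.sum_eq_zero fun a _ => ?_
  simp only [smul_comm (eta _ _) (eta a a), ← Finset.smul_sum, (hW a).cons a J, smul_zero]

theorem sum_eta_smul_sumErase_cons_cons (hW : ∀ ρ, IsTraceless (W ρ)) (J : Multiset (Fin 4)) :
    ∑ a, eta a a • sumErase W (a ::ₘ a ::ₘ J) = (2 : ℂ) • divergence W J := by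
  have hzero : ∑ a, eta a a • sumErase (fun ρ K => W ρ (a ::ₘ a ::ₘ K)) J = 0 := by
    simp only [sum_smul_sumErase, hW _ _, sumErase_zero]
  simp only [sumErase_cons, smul_add, Finset.sum_add_distrib, hzero, divergence]
  module

theorem IsTraceless.sum_eta_smul_box (hG : IsTraceless G) (J : Multiset (Fin 4)) :
    ∑ a, eta a a • box (fun K => G (a ::ₘ a ::ₘ K)) J = 0 := by
  simp only [box, sum_smul_sumErase, smul_comm (eta _ _) (eta _ _), ← Finset.smul_sum, hG _,
    smul_zero, sumErase_zero]

theorem IsTraceless.sum_eta_smul_box_cons_cons (hG : IsTraceless G) (J : Multiset (Fin 4)) :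
    ∑ a, eta a a • box G (a ::ₘ a ::ₘ J) = (4 * ((J.card : ℂ) + 2)) • G J := by
  have hbox : ∀ a, eta a a • box G (a ::ₘ a ::ₘ J) = (2 : ℂ) • (eta a a • eta a a • G J) +
      (4 : ℂ) • (eta a a • sumErase (fun σ K => eta a σ • G (a ::ₘ K)) J) +
      eta a a • box (fun K => G (a ::ₘ a ::ₘ K)) J := fun a => by
    rw [box_cons, box_cons, sumErase_cons]
    module
  simp only [hbox, Finset.sum_add_distrib, ← Finset.smul_sum, sum_eta_smul_eta_smul_self,
    sum_eta_smul_sumErase, hG.sum_eta_smul_box]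
  module

theorem isTraceless_tracelessSym (hW : ∀ ρ, IsTraceless (W ρ)) :
    IsTraceless (tracelessSym W) := fun J => by
  simp only [tracelessSym, Multiset.card_cons, smul_sub, Finset.sum_sub_distrib,
    smul_comm (eta _ _), ← Finset.smul_sum, sum_eta_smul_sumErase_cons_cons hW,
    (isTraceless_divergence hW).sum_eta_smul_box_cons_cons]
  push_cast
  module

theorem IsTraceless.tracelessSym_cons (hG : IsTraceless G) (J : Multiset (Fin 4)) :
    tracelessSym (fun ρ K => G (ρ ::ₘ K)) J = ((J.card : ℂ) ^ 2) • G J := by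
  have hdiv : divergence (fun ρ K => G (ρ ::ₘ K)) = fun _ => 0 := funext hG
  rw [tracelessSym, sumErase_cons_self, hdiv, ← Nat.cast_smul_eq_nsmul ℂ]
  simp only [box, smul_zero, sumErase_zero]
  module

theorem IsTraceless.sum_eta_smul_tracelessSym (hG : IsTraceless G) (J : Multiset (Fin 4)) :
    ∑ a, eta a a • tracelessSym (fun σ K => eta a σ • G K) (a ::ₘ J) =
      (((J.card : ℂ) + 2) ^ 2) • G J := by
  have hsym : ∀ a, eta a a • tracelessSym (fun σ K => eta a σ • G K) (a ::ₘ J) =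
      ((J.card : ℂ) + 1) • (eta a a • eta a a • G J) +
      (J.card : ℂ) • (eta a a • sumErase (fun σ K => eta a σ • G (a ::ₘ K)) J) -
      (1 / 2 : ℂ) • (eta a a • box (fun K => G (a ::ₘ a ::ₘ K)) J) := fun a => by
    rw [tracelessSym, divergence_eta_smul, sumErase_cons, box_cons, Multiset.card_cons]
    push_cast
    module
  simp only [hsym, Finset.sum_add_distrib, Finset.sum_sub_distrib, ← Finset.smul_sum,
    sum_eta_smul_eta_smul_self, sum_eta_smul_sumErase, hG.sum_eta_smul_box]
  module

end Metric

/-! ### The homotopy and its Laplacian -/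

theorem lift_eq_zero_of_isTraceless {A : Type} [Ring A] [Algebra ℂ A] {f : JetVar → A}
    (hf : ∀ y, IsTraceless fun J => f (y, J)) (r : FreeAlgebra ℂ JetVar) (hr : r ∈ onShell) :
    FreeAlgebra.lift ℂ f r = 0 := by
  obtain ⟨y, J, rfl⟩ := hr
  rw [sum_sum_eta_smul fun ρ σ => FreeAlgebra.ι ℂ ((y, ρ ::ₘ σ ::ₘ J) : JetVar)]
  simpa only [map_sum, map_smul, FreeAlgebra.lift_ι_apply] using hf y J

theorem isTraceless_jet (y : FieldName) : IsTraceless (jet y) := fun J => by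
  rw [← sum_sum_eta_smul fun ρ σ => jet y (ρ ::ₘ σ ::ₘ J)]
  exact jet_onShell y J

theorem adjoin_range_jet : Algebra.adjoin ℂ (Set.range fun x : JetVar => jet x.1 x.2) = ⊤ :=
  SuperPoly.adjoin_range_gen

theorem B_eq_sum (J : Multiset (Fin 4)) : B J = ∑ a, eta a a • jet (.v a) (a ::ₘ J) :=
  sum_sum_eta_smul fun ρ σ => jet (.v σ) (ρ ::ₘ J)

theorem divergence_jet_v : divergence (fun ρ => jet (.v ρ)) = B :=
  funext fun J => (B_eq_sum J).symm

/-- The parity automorphism of `𝒫`: it fixes `v` and negates `u` and `ũ`. -/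
def parity : P →ₐ[ℂ] P :=
  SuperPoly.lift JetVar.odd onShell (fun x => koszul true x.odd • jet x.1 x.2)
    (fun x y => by
      rw [smul_mul_smul_comm, jet_mul_jet, smul_mul_smul_comm]
      exact (smul_comm _ _ _).trans (by rw [mul_comm]; rfl))
    (lift_eq_zero_of_isTraceless fun y =>
      (isTraceless_jet y).map (LinearMap.lsmul ℂ P (koszul true y.odd)))

theorem parity_jet (y : FieldName) (J : Multiset (Fin 4)) :
    parity (jet y J) = koszul true y.odd • jet y J :=
  SuperPoly.lift_gen _ _ _ _ _ _

theorem parity_comp_parity : parity.comp parity = .id ℂ P :=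
  AlgHom.ext_of_adjoin_eq_top adjoin_range_jet <| by
    rintro _ ⟨⟨y, J⟩, rfl⟩
    cases h : y.odd <;> simp [parity_jet, koszul, h]

theorem parity_B (J : Multiset (Fin 4)) : parity (B J) = B J := by
  simp [B_eq_sum, parity_jet, koszul, FieldName.odd]

theorem IsTwistedDerivation.parity_anticomm {D : P →ₗ[ℂ] P}
    (hD : IsTwistedDerivation parity (.id ℂ P) D)
    (h : ∀ y J, parity (D (jet y J)) = -koszul true y.odd • D (jet y J)) :
    parity.toLinearMap ∘ₗ D + D ∘ₗ parity.toLinearMap = 0 :=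
  ((hD.algHom_comp parity).add (hD.comp_algHom parity)).eq_zero_of_adjoin_eq_top
    adjoin_range_jet <| by
      rintro _ ⟨⟨y, J⟩, rfl⟩
      simp [h, parity_jet]

theorem isTwistedDerivation_dQ : IsTwistedDerivation parity (.id ℂ P) dQ :=
  SuperPoly.isTwistedDerivation_derivation dQVar_swap dQVar_rel fun x => parity_jet x.1 x.2

theorem parity_dQ_jet (y : FieldName) (J : Multiset (Fin 4)) :
    parity (dQ (jet y J)) = -koszul true y.odd • dQ (jet y J) := by
  cases y <;> simp [dQ_jet, dQVar, parity_jet, parity_B, koszul, FieldName.odd]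

/-- The values of the homotopy on the jets. Up to normalization, `u_{;J}` goes to the traceless
symmetric part of `v_{ρ;J∖ρ}` and `v_{σ;J}` to that of `η_{στ} ũ_{;J∖τ}`. The value on `u` itself
is `0`, the symmetrization over the empty multi-index. -/
def homotopyVar : JetVar → P
  | (.v σ, J) => (Complex.I / ((J.card : ℂ) + 1) ^ 2) •
      tracelessSym (fun τ K => eta σ τ • jet .uTilde K) J
  | (.u, J) => (-Complex.I / (J.card : ℂ) ^ 2) • tracelessSym (fun ρ => jet (.v ρ)) J
  | (.uTilde, _) => 0

theorem homotopyVar_mul_jet (x : JetVar) (y : FieldName) (K : Multiset (Fin 4)) :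
    homotopyVar x * jet y K = koszul (xor true x.odd) y.odd • (jet y K * homotopyVar x) := by
  let right : P →ₗ[ℂ] P := LinearMap.mulRight ℂ (jet y K)
  let left : P →ₗ[ℂ] P := koszul (xor true x.odd) y.odd • LinearMap.mulLeft ℂ (jet y K)
  change right (homotopyVar x) = left (homotopyVar x)
  obtain ⟨_ | _ | _, J⟩ := x
  · rw [homotopyVar, map_smul, map_smul]
    congr 1
    refine map_tracelessSym_congr (fun τ L => ?_) J
    simp [right, left, jet_mul_jet .uTilde y, JetVar.odd, FieldName.odd, smul_comm (eta _ _)]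
  · rw [homotopyVar, map_smul, map_smul]
    congr 1
    refine map_tracelessSym_congr (fun ρ L => ?_) J
    simp [right, left, jet_mul_jet (.v ρ) y, JetVar.odd, FieldName.odd, koszul]
  · simp [homotopyVar]

theorem isTraceless_homotopyVar (y : FieldName) : IsTraceless fun J => homotopyVar (y, J) := by
  cases y with
  | v σ =>
    exact (isTraceless_tracelessSym fun τ => (isTraceless_jet .uTilde).map
      (LinearMap.lsmul ℂ P (eta σ τ))).card_smul fun n => Complex.I / ((n : ℂ) + 1) ^ 2
  | u =>
    exact (isTraceless_tracelessSym fun ρ => isTraceless_jet (.v ρ)).card_smul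
      fun n => -Complex.I / (n : ℂ) ^ 2
  | uTilde => intro J; simp [homotopyVar]

theorem isTraceless_derivMatrix (k : Bool) {δ : JetVar → P}
    (hδ : ∀ y, IsTraceless fun J => δ (y, J)) (y : FieldName) :
    IsTraceless fun J => derivMatrix JetVar.odd onShell k δ (y, J) := fun J => by
  have hgen : ∀ K, SuperPoly.gen JetVar.odd onShell (y, K) = jet y K := fun _ => rfl
  ext i j
  rw [Matrix.sum_apply]
  fin_cases i <;> fin_cases j
  · simpa [derivMatrix, hgen, JetVar.odd] using
      (isTraceless_jet y).map (LinearMap.lsmul ℂ P (koszul k y.odd)) J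
  · simpa [derivMatrix] using hδ y J
  · simp [derivMatrix]
  · simpa [derivMatrix, hgen] using isTraceless_jet y J

theorem homotopyVar_swap (x y : JetVar) :
    derivMatrix JetVar.odd onShell true homotopyVar x *
      derivMatrix JetVar.odd onShell true homotopyVar y = koszul x.odd y.odd •
        (derivMatrix JetVar.odd onShell true homotopyVar y *
          derivMatrix JetVar.odd onShell true homotopyVar x) :=
  derivMatrix_swap _ _ _ _ (fun x y => homotopyVar_mul_jet x y.1 y.2) x y

theorem homotopyVar_rel (r : FreeAlgebra ℂ JetVar) (hr : r ∈ onShell) :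
    FreeAlgebra.lift ℂ (derivMatrix JetVar.odd onShell true homotopyVar) r = 0 :=
  lift_eq_zero_of_isTraceless (isTraceless_derivMatrix true isTraceless_homotopyVar) r hr

/-- The contracting homotopy, an odd derivation of `𝒫`. -/
def homotopy : P →ₗ[ℂ] P :=
  SuperPoly.derivation JetVar.odd onShell true homotopyVar homotopyVar_swap homotopyVar_rel

theorem homotopy_jet (y : FieldName) (J : Multiset (Fin 4)) :
    homotopy (jet y J) = homotopyVar (y, J) :=
  SuperPoly.derivation_gen _ _ _ _ _ _ _

theorem isTwistedDerivation_homotopy : IsTwistedDerivation parity (.id ℂ P) homotopy :=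
  SuperPoly.isTwistedDerivation_derivation homotopyVar_swap homotopyVar_rel
    fun x => parity_jet x.1 x.2

theorem parity_homotopy_jet (y : FieldName) (J : Multiset (Fin 4)) :
    parity (homotopy (jet y J)) = -koszul true y.odd • homotopy (jet y J) := by
  let negSign : P →ₗ[ℂ] P := -koszul true y.odd • LinearMap.id
  change parity.toLinearMap (homotopy (jet y J)) = negSign (homotopy (jet y J))
  cases y with
  | v σ =>
    rw [homotopy_jet, homotopyVar, map_smul, map_smul]
    congr 1
    refine map_tracelessSym_congr (fun τ K => ?_) J
    simp [negSign, parity_jet, koszul, FieldName.odd]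
  | u =>
    rw [homotopy_jet, homotopyVar, map_smul, map_smul]
    congr 1
    refine map_tracelessSym_congr (fun τ K => ?_) J
    simp [negSign, parity_jet, koszul, FieldName.odd]
  | uTilde => simp [homotopy_jet, homotopyVar]

/-- The Laplacian `d_Q h + h d_Q` of the homotopy `h`. -/
def laplacian : Module.End ℂ P := dQ * homotopy + homotopy * dQ

theorem isTwistedDerivation_laplacian :
    IsTwistedDerivation (.id ℂ P) (.id ℂ P) laplacian := by
  have hanti := isTwistedDerivation_dQ.anticommutator isTwistedDerivation_homotopy
    (isTwistedDerivation_dQ.parity_anticomm parity_dQ_jet)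
    (isTwistedDerivation_homotopy.parity_anticomm parity_homotopy_jet)
  rwa [parity_comp_parity] at hanti

theorem laplacian_apply (p : P) : laplacian p = dQ (homotopy p) + homotopy (dQ p) := rfl

theorem homotopy_B (J : Multiset (Fin 4)) : homotopy (B J) = Complex.I • jet .uTilde J := by
  have hcard : (J.card : ℂ) + 2 ≠ 0 := by exact_mod_cast (J.card + 1).succ_ne_zero
  calc homotopy (B J)
      = (Complex.I / ((J.card : ℂ) + 2) ^ 2) •
          ∑ a, eta a a • tracelessSym (fun τ K => eta a τ • jet .uTilde K) (a ::ₘ J) := by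
        simp only [B_eq_sum, map_sum, map_smul, homotopy_jet, homotopyVar, Multiset.card_cons,
          Finset.smul_sum, smul_comm (eta _ _) (_ / _)]
        push_cast
        norm_num [add_assoc]
    _ = Complex.I • jet .uTilde J := by
        rw [(isTraceless_jet .uTilde).sum_eta_smul_tracelessSym, smul_smul,
          div_mul_cancel₀ _ (pow_ne_zero 2 hcard)]

theorem laplacian_jet_uTilde (J : Multiset (Fin 4)) :
    laplacian (jet .uTilde J) = jet .uTilde J := by
  simp [laplacian_apply, homotopy_jet, dQ_jet, homotopyVar, dQVar, homotopy_B, smul_smul]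

theorem laplacian_jet_u (J : Multiset (Fin 4)) :
    laplacian (jet .u J) = if J = 0 then 0 else jet .u J := by
  have hsym : dQ (tracelessSym (fun ρ => jet (.v ρ)) J) =
      (Complex.I * (J.card : ℂ) ^ 2) • jet .u J := by
    have htraceless := (isTraceless_jet .u).map (LinearMap.lsmul ℂ P Complex.I)
    simpa only [map_tracelessSym, dQ_jet, dQVar, LinearMap.lsmul_apply, smul_smul, mul_comm]
      using htraceless.tracelessSym_cons J
  rw [laplacian_apply, homotopy_jet, dQ_jet, homotopyVar, dQVar, map_smul, hsym, map_zero, add_zero,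
    smul_smul]
  split_ifs with h
  · simp [h]
  · have hcard : (J.card : ℂ) ≠ 0 := by simpa using h
    rw [← mul_assoc, div_mul_eq_mul_div, div_mul_cancel₀ _ (pow_ne_zero 2 hcard)]
    simp

theorem sumErase_sumErase_eta_smul_B (σ : Fin 4) (J : Multiset (Fin 4)) :
    sumErase (fun μ => sumErase fun ρ K => eta σ ρ • B (μ ::ₘ K)) J =
      ((J.card : ℂ) - 1) • sumErase (fun τ K => eta σ τ • B K) J := by
  rw [sumErase_comm fun μ ρ K => eta σ ρ • B (μ ::ₘ K), smul_sumErase]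
  refine sumErase_congr fun ρ K h => ?_
  rw [← smul_sumErase, sumErase_cons_self, ← Nat.cast_smul_eq_nsmul ℂ, h, Multiset.card_cons]
  push_cast
  module

theorem sumErase_F0 (σ : Fin 4) (J : Multiset (Fin 4)) :
    sumErase (fun μ K => F0 μ σ K) J = (J.card : ℂ) • jet (.v σ) J -
      sumErase (fun ρ K => jet (.v ρ) (σ ::ₘ K)) J + (1 / ((J.card : ℂ) + 1)) •
        (box (fun K => B (σ ::ₘ K)) J -
          ((J.card : ℂ) - 1) • sumErase (fun τ K => eta σ τ • B K) J) := by
  rw [← sumErase_sumErase_eta_smul_B, box, ← sumErase_sub, Nat.cast_smul_eq_nsmul,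
    ← sumErase_cons_self, ← sumErase_sub, smul_sumErase, ← sumErase_add]
  refine sumErase_congr fun μ K h => ?_
  have htrace : traceTerm μ σ K = sumErase (fun ρ L => eta μ ρ • B (σ ::ₘ L)) K -
      sumErase (fun ρ L => eta σ ρ • B (μ ::ₘ L)) K := by
    rw [← sumErase_sub]
    rfl
  rw [F0, F, htrace, h, Multiset.card_cons]
  congr 3
  push_cast
  ring

theorem laplacian_jet_v (σ : Fin 4) (J : Multiset (Fin 4)) :
    laplacian (jet (.v σ) J) = jet (.v σ) J -
      (1 / ((J.card : ℂ) + 1)) • sumErase (fun μ K => F0 μ σ K) J := by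
  have hcard : (J.card : ℂ) + 1 ≠ 0 := by exact_mod_cast J.card.succ_ne_zero
  have hsym : dQ (tracelessSym (fun τ K => eta σ τ • jet .uTilde K) J) =
      -Complex.I • tracelessSym (fun τ K => eta σ τ • B K) J :=
    (map_tracelessSym dQ _ J).trans <| .symm <|
      (map_tracelessSym (LinearMap.lsmul ℂ P (-Complex.I)) _ J).trans <| by
        simp [dQ_jet, dQVar, smul_comm (eta _ _)]
  rw [laplacian_apply, homotopy_jet, dQ_jet, homotopyVar, dQVar, map_smul, hsym, map_smul,
    homotopy_jet, homotopyVar, tracelessSym, tracelessSym, divergence_eta_smul, divergence_jet_v,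
    sumErase_cons, box_cons, Multiset.card_cons, sumErase_F0]
  push_cast
  match_scalars <;> field_simp <;> simp only [Complex.I_sq] <;> ring

/-! ### The retraction onto the reduced algebra -/

/-- The generators `u` and `F⁽⁰⁾_{μν;J}` of the reduced algebra. -/
def redGen (x : PhysVar) : ReducedP0 := ReducedP0.mk (physGen x)

instance : IsAddTorsionFree ReducedP0 := .of_isTorsionFree ℂ ReducedP0

theorem ReducedP0.mk_surjective : Function.Surjective ReducedP0.mk :=
  RingQuot.mkAlgHom_surjective ℂ BianchiRel

theorem adjoin_range_redGen : Algebra.adjoin ℂ (Set.range redGen) = ⊤ := by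
  have hrange : Set.range redGen = ReducedP0.mk '' Set.range physGen :=
    Set.range_comp ReducedP0.mk physGen
  rw [hrange, ← AlgHom.map_adjoin, show Algebra.adjoin ℂ (Set.range physGen) = ⊤ from
    SuperPoly.adjoin_range_gen, Algebra.map_top, AlgHom.range_eq_top]
  exact ReducedP0.mk_surjective

theorem redGen_F0_antisymm (μ ν : Fin 4) (J : Multiset (Fin 4)) :
    redGen (.F0 μ ν J) = -redGen (.F0 ν μ J) := by
  have h := congrArg ReducedP0.mk (SuperPoly.mk_eq_zero PhysVar.odd {r | TracelessRelator r}
    (TracelessRelator.antisymm μ ν J))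
  simp only [map_add, map_zero] at h
  exact eq_neg_of_add_eq_zero_left h

theorem redGen_F0_self (μ : Fin 4) (J : Multiset (Fin 4)) : redGen (.F0 μ μ J) = 0 :=
  self_eq_neg.1 (redGen_F0_antisymm μ μ J)

theorem isTraceless_redGen_F0 (μ ν : Fin 4) :
    IsTraceless fun J => redGen (.F0 μ ν J) := fun J => by
  have h := congrArg ReducedP0.mk (SuperPoly.mk_eq_zero PhysVar.odd {r | TracelessRelator r}
    (TracelessRelator.trace_deriv μ ν J))
  rw [sum_sum_eta_smul fun ρ σ => FreeAlgebra.ι ℂ (PhysVar.F0 μ ν (ρ ::ₘ σ ::ₘ J))] at h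
  simp only [map_sum, map_smul, map_zero] at h
  exact h

theorem divergence_redGen_F0 (ν : Fin 4) :
    divergence (fun μ J => redGen (.F0 μ ν J)) = fun _ => 0 := funext fun J => by
  have h := congrArg ReducedP0.mk (SuperPoly.mk_eq_zero PhysVar.odd {r | TracelessRelator r}
    (TracelessRelator.trace ν J))
  rw [sum_sum_eta_smul fun μ ρ => FreeAlgebra.ι ℂ (PhysVar.F0 μ ν (ρ ::ₘ J))] at h
  simp only [map_sum, map_smul, map_zero] at h
  exact h

theorem redGen_F0_bianchi (μ ν ρ : Fin 4) (J : Multiset (Fin 4)) :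
    redGen (.F0 μ ν (ρ ::ₘ J)) + redGen (.F0 ν ρ (μ ::ₘ J)) + redGen (.F0 ρ μ (ν ::ₘ J)) = 0 := by
  have h : ReducedP0.mk _ = ReducedP0.mk 0 :=
    RingQuot.mkAlgHom_rel ℂ (BianchiRel.bianchi μ ν ρ J)
  simp only [map_add, map_zero] at h
  exact h

theorem redGen_F0_mem_center (μ ν : Fin 4) (J : Multiset (Fin 4)) :
    redGen (.F0 μ ν J) ∈ Subalgebra.center ℂ ReducedP0 := by
  have hgen : physGen (.F0 μ ν J) ∈ Subalgebra.center ℂ FormalP0 := SuperPoly.gen_mem_center rfl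
  refine Subalgebra.mem_center_iff.2 <| ReducedP0.mk_surjective.forall.2 fun b => ?_
  rw [redGen, ← map_mul, ← map_mul, Subalgebra.mem_center_iff.1 hgen]

theorem redGen_u_mul_self : redGen .u * redGen .u = 0 := by
  have h := congrArg ReducedP0.mk (SuperPoly.gen_mul_gen PhysVar.odd {r | TracelessRelator r} .u .u)
  simp only [koszul, PhysVar.odd, Bool.and_self, if_true, neg_one_smul, map_neg, map_mul] at h
  exact self_eq_neg.1 h

/-- The values of the projection on the jets. The formula for `v` is a Poincaré-lemma primitive of
`F⁽⁰⁾`, in the gauge `x^σ v_σ = 0`. -/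
def projVar : JetVar → ReducedP0
  | (.v σ, J) => (1 / ((J.card : ℂ) + 1)) • sumErase (fun μ K => redGen (.F0 μ σ K)) J
  | (.u, J) => if J = 0 then redGen .u else 0
  | (.uTilde, _) => 0

theorem projVar_mem_center {x : JetVar} (hx : x.odd = false) :
    projVar x ∈ Subalgebra.center ℂ ReducedP0 := by
  obtain ⟨_ | _ | _, J⟩ := x
  · refine Subalgebra.smul_mem _ (multiset_sum_mem _ fun z hz => ?_) _
    obtain ⟨ρ, -, rfl⟩ := Multiset.mem_map.1 hz
    exact redGen_F0_mem_center _ _ _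
  all_goals cases hx

theorem projVar_mul_projVar_of_odd {x y : JetVar} (hx : x.odd = true) (hy : y.odd = true) :
    projVar x * projVar y = 0 := by
  obtain ⟨_ | _ | _, J⟩ := x <;> obtain ⟨_ | _ | _, K⟩ := y <;>
    simp_all [projVar, JetVar.odd, FieldName.odd, redGen_u_mul_self]

theorem projVar_mul_projVar (x y : JetVar) :
    projVar x * projVar y = koszul x.odd y.odd • (projVar y * projVar x) := by
  cases hx : x.odd
  · simp [koszul, Subalgebra.mem_center_iff.1 (projVar_mem_center hx) (projVar y)]
  cases hy : y.odd
  · simp [koszul, Subalgebra.mem_center_iff.1 (projVar_mem_center hy) (projVar x)]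
  rw [projVar_mul_projVar_of_odd hx hy, projVar_mul_projVar_of_odd hy hx, smul_zero]

theorem isTraceless_projVar (y : FieldName) : IsTraceless fun J => projVar (y, J) := by
  cases y with
  | v σ =>
    have hsum : IsTraceless (sumErase fun μ K => redGen (.F0 μ σ K)) := fun J => by
      rw [sum_eta_smul_sumErase_cons_cons fun μ => isTraceless_redGen_F0 μ σ,
        divergence_redGen_F0, smul_zero]
    exact hsum.card_smul fun n => 1 / ((n : ℂ) + 1)
  | u => intro J; simp [projVar]
  | uTilde => intro J; simp [projVar]

/-- The retraction of `𝒫` onto the reduced algebra. -/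
def proj : P →ₐ[ℂ] ReducedP0 :=
  SuperPoly.lift JetVar.odd onShell projVar projVar_mul_projVar
    (lift_eq_zero_of_isTraceless isTraceless_projVar)

theorem proj_jet (y : FieldName) (J : Multiset (Fin 4)) : proj (jet y J) = projVar (y, J) :=
  SuperPoly.lift_gen _ _ _ _ _ _

theorem proj_B (J : Multiset (Fin 4)) : proj (B J) = 0 := by
  have htrace : ∀ μ K, ∑ a, eta a a • redGen (.F0 μ a (a ::ₘ K)) = 0 := fun μ K => by
    simp only [redGen_F0_antisymm μ, smul_neg, Finset.sum_neg_distrib, neg_eq_zero]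
    exact congrFun (divergence_redGen_F0 μ) K
  simp only [B_eq_sum, map_sum, map_smul, proj_jet, projVar, Multiset.card_cons, sumErase_cons,
    redGen_F0_self, zero_add, smul_comm (eta _ _), ← Finset.smul_sum, sum_smul_sumErase, htrace,
    sumErase_zero, smul_zero]

theorem proj_dQ (p : P) : proj (dQ p) = 0 := by
  refine LinearMap.congr_fun ((isTwistedDerivation_dQ.algHom_comp proj).eq_zero_of_adjoin_eq_top
    adjoin_range_jet ?_) p
  rintro _ ⟨⟨y, J⟩, rfl⟩
  cases y <;> simp [dQ_jet, dQVar, proj_jet, projVar, proj_B]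

theorem proj_traceTerm (μ ν : Fin 4) (J : Multiset (Fin 4)) : proj (traceTerm μ ν J) = 0 := by
  simp [traceTerm, map_multiset_sum, proj_B]

theorem sumErase_redGen_F0_sub (μ ν : Fin 4) (J : Multiset (Fin 4)) :
    sumErase (fun ρ K => redGen (.F0 ρ ν (μ ::ₘ K))) J -
      sumErase (fun ρ K => redGen (.F0 ρ μ (ν ::ₘ K))) J = (J.card : ℂ) • redGen (.F0 μ ν J) := by
  rw [← sumErase_sub, Nat.cast_smul_eq_nsmul, ← sumErase_cons_self fun J => redGen (.F0 μ ν J)]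
  refine sumErase_congr fun ρ K _ => ?_
  linear_combination (norm := abel) redGen_F0_antisymm ρ ν (μ ::ₘ K) - redGen_F0_bianchi μ ν ρ K

theorem proj_F0 (μ ν : Fin 4) (J : Multiset (Fin 4)) :
    proj (F0 μ ν J) = redGen (.F0 μ ν J) := by
  have hcard : (J.card : ℂ) + 1 + 1 ≠ 0 := by exact_mod_cast (J.card + 1).succ_ne_zero
  rw [F0, F, map_add, map_sub, map_smul, proj_traceTerm, proj_jet, proj_jet, projVar, projVar,
    Multiset.card_cons, Multiset.card_cons, sumErase_cons, sumErase_cons,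
    eq_add_of_sub_eq (sumErase_redGen_F0_sub μ ν J), redGen_F0_antisymm ν μ]
  push_cast
  match_scalars <;> field_simp <;> ring

theorem proj_evalVar (x : PhysVar) : proj (evalVar x) = redGen x := by
  cases x with
  | u => simp [evalVar, proj_jet, projVar]
  | F0 μ ν J => exact proj_F0 μ ν J

/-- The natural map from the reduced algebra to `𝒫`. -/
def incl : ReducedP0 →ₐ[ℂ] P :=
  RingQuot.liftAlgHom ℂ ⟨evalP0, by
    rintro _ _ ⟨μ, ν, ρ, J⟩
    simpa only [map_add, map_zero, evalP0_physGen, evalVar] using F0_bianchi μ ν ρ J⟩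

theorem incl_mk (x : FormalP0) : incl (ReducedP0.mk x) = evalP0 x :=
  RingQuot.liftAlgHom_mkAlgHom_apply ℂ _ _ _

theorem incl_redGen (x : PhysVar) : incl (redGen x) = evalVar x := by
  rw [redGen, incl_mk, evalP0_physGen]

theorem proj_comp_incl : proj.comp incl = .id ℂ ReducedP0 :=
  AlgHom.ext_of_adjoin_eq_top adjoin_range_redGen <| by
    rintro _ ⟨x, rfl⟩
    simp [incl_redGen, proj_evalVar]

theorem P0_eq_adjoin_range_evalVar : P0 = Algebra.adjoin ℂ (Set.range evalVar) := by
  refine congrArg (Algebra.adjoin ℂ) (Set.ext fun p => ⟨?_, ?_⟩)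
  · rintro (rfl | ⟨μ, ν, J, rfl⟩)
    exacts [⟨.u, rfl⟩, ⟨.F0 μ ν J, rfl⟩]
  · rintro ⟨_ | ⟨μ, ν, J⟩, rfl⟩
    exacts [.inl rfl, .inr ⟨μ, ν, J, rfl⟩]

theorem range_incl : incl.range = P0 := by
  rw [P0_eq_adjoin_range_evalVar, ← Algebra.map_top, ← adjoin_range_redGen, AlgHom.map_adjoin,
    ← Set.range_comp]
  exact congrArg (fun f => Algebra.adjoin ℂ (Set.range f)) (funext incl_redGen)

theorem incl_mem_P0 (x : ReducedP0) : incl x ∈ P0 :=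
  range_incl ▸ AlgHom.mem_range_self incl x

theorem IsTwistedDerivation.P0_le_ker {α β : P →ₐ[ℂ] P} {D : P →ₗ[ℂ] P}
    (hD : IsTwistedDerivation α β D) (h : ∀ x, D (evalVar x) = 0) :
    Subalgebra.toSubmodule P0 ≤ LinearMap.ker D := by
  rw [P0_eq_adjoin_range_evalVar]
  exact hD.adjoin_le_ker (Set.forall_mem_range.2 h)

theorem P0_le_ZQ : Subalgebra.toSubmodule P0 ≤ ZQ :=
  isTwistedDerivation_dQ.P0_le_ker fun x => by
    cases x with
    | u => simp [evalVar, dQ_jet, dQVar]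
    | F0 μ ν J => exact dQ_F0 μ ν J

/-! ### The cohomology -/

theorem laplacian_jet (y : FieldName) (J : Multiset (Fin 4)) :
    laplacian (jet y J) = jet y J - incl (proj (jet y J)) := by
  cases y with
  | v σ =>
    have hincl := map_sumErase incl (fun μ K => redGen (.F0 μ σ K)) J
    simp only [laplacian_jet_v, proj_jet, projVar, map_smul, hincl, incl_redGen, evalVar]
  | u =>
    rw [laplacian_jet_u, proj_jet, projVar]
    split_ifs with h <;> simp [incl_redGen, evalVar, h]
  | uTilde => simp [laplacian_jet_uTilde, proj_jet, projVar]

theorem F0_mem {S : Submodule ℂ P} (hS : ∀ y J, jet y J ∈ S) (μ ν : Fin 4)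
    (J : Multiset (Fin 4)) : F0 μ ν J ∈ S := by
  have hB : ∀ K, B K ∈ S := fun K => by
    rw [B_eq_sum]
    exact sum_mem fun a _ => S.smul_mem _ (hS _ _)
  refine add_mem (sub_mem (hS _ _) (hS _ _)) (S.smul_mem _ (multiset_sum_mem _ fun z hz => ?_))
  obtain ⟨ρ, -, rfl⟩ := Multiset.mem_map.1 hz
  exact sub_mem (S.smul_mem _ (hB _)) (S.smul_mem _ (hB _))

theorem laplacian_F0 (μ ν : Fin 4) (J : Multiset (Fin 4)) : laplacian (F0 μ ν J) = 0 := by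
  have hlin : F0 μ ν J ∈ LinearMap.eqLocus laplacian
      (LinearMap.id - incl.toLinearMap ∘ₗ proj.toLinearMap) :=
    F0_mem laplacian_jet μ ν J
  rw [show laplacian (F0 μ ν J) = F0 μ ν J - incl (proj (F0 μ ν J)) from hlin, proj_F0,
    incl_redGen, evalVar, sub_self]

theorem P0_le_ker_laplacian : Subalgebra.toSubmodule P0 ≤ LinearMap.ker laplacian :=
  isTwistedDerivation_laplacian.P0_le_ker fun x => by
    cases x with
    | u => simp [evalVar, laplacian_jet_u]
    | F0 μ ν J => exact laplacian_F0 μ ν J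

theorem jet_mem_P0_sup_eigenspace_one (y : FieldName) (J : Multiset (Fin 4)) :
    jet y J ∈ Subalgebra.toSubmodule P0 ⊔ laplacian.eigenspace 1 := by
  refine Submodule.mem_sup.2 ⟨incl (proj (jet y J)), incl_mem_P0 _,
    jet y J - incl (proj (jet y J)), ?_, add_sub_cancel _ _⟩
  rw [Module.End.mem_eigenspace_iff, one_smul, map_sub, laplacian_jet,
    P0_le_ker_laplacian (incl_mem_P0 _), sub_zero]

theorem ZQ_le_P0_sup_BQ : ZQ ≤ Subalgebra.toSubmodule P0 ⊔ BQ :=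
  ker_le_sup_range (LinearMap.ext dQ_dQ) P0_le_ZQ <|
    sup_positivePart_eq_top isTwistedDerivation_laplacian P0_le_ker_laplacian adjoin_range_jet <|
      Set.forall_mem_range.2 fun x => jet_mem_P0_sup_eigenspace_one x.1 x.2

/-- The map from the reduced algebra to the cohomology induced by `incl`. -/
def inclHQ : ReducedP0 →ₗ[ℂ] HQ :=
  HQ.mk ∘ₗ incl.toLinearMap.codRestrict ZQ fun x => P0_le_ZQ (incl_mem_P0 x)

theorem inclHQ_injective : Function.Injective inclHQ := by
  refine (injective_iff_map_eq_zero _).2 fun x hx => ?_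
  obtain ⟨p, hp⟩ : incl x ∈ BQ :=
    (Submodule.Quotient.mk_eq_zero (BQ.submoduleOf ZQ)).1 hx
  calc x = proj (incl x) := (AlgHom.congr_fun proj_comp_incl x).symm
    _ = 0 := by rw [← hp, proj_dQ]

theorem inclHQ_surjective : Function.Surjective inclHQ := by
  refine (Submodule.mkQ_surjective _).forall.2 fun ⟨p, hp⟩ => ?_
  obtain ⟨p₀, hp₀, q, hq, rfl⟩ := Submodule.mem_sup.1 (ZQ_le_P0_sup_BQ hp)
  obtain ⟨x, rfl⟩ : p₀ ∈ incl.range := range_incl ▸ hp₀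
  refine ⟨x, ((Submodule.Quotient.eq _).2 ?_).symm⟩
  change incl x + q - incl x ∈ BQ
  rwa [add_sub_cancel_left]

end

end GaugeCohomology

theorem mainTheorem3 :
    (∀ p ∈ GaugeCohomology.ZQ, ∃ p₀ ∈ GaugeCohomology.P0, p - p₀ ∈ GaugeCohomology.BQ) ∧
    ∃ e : GaugeCohomology.ReducedP0 ≃ₗ[ℂ] GaugeCohomology.HQ,
      ∀ x : GaugeCohomology.FormalP0, ∃ hx : GaugeCohomology.evalP0 x ∈ GaugeCohomology.ZQ,
        e (GaugeCohomology.ReducedP0.mk x) =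
          GaugeCohomology.HQ.mk ⟨GaugeCohomology.evalP0 x, hx⟩ := by
  refine ⟨fun p hp => ?_, LinearEquiv.ofBijective GaugeCohomology.inclHQ
    ⟨GaugeCohomology.inclHQ_injective, GaugeCohomology.inclHQ_surjective⟩, fun x => ?_⟩
  · obtain ⟨p₀, hp₀, q, hq, rfl⟩ := Submodule.mem_sup.1 (GaugeCohomology.ZQ_le_P0_sup_BQ hp)
    exact ⟨p₀, hp₀, by rwa [add_sub_cancel_left]⟩
  · have hincl := GaugeCohomology.incl_mk x
    refine ⟨hincl ▸ GaugeCohomology.P0_le_ZQ (GaugeCohomology.incl_mem_P0 _), ?_⟩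
    exact congrArg GaugeCohomology.HQ.mk (Subtype.ext hincl)
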